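/- **Theorem (Dynamics of charged dust).** *Setting.* Let $m\ge 0$, let $W$ be a compact manifold of dimension $m$, and let $(M,g)$ be a smooth semi-Riemannian manifold of dimension $5+m$ with Levi-Civita connection $\nabla$. Let $M$ carry an $(S^1,W)$-multi-fiber bundle structure: a smooth fibration $\pi:M\to B$ with fiber $S^1\times W$ over a $4$-manifold $B$, together with a smooth map $\Phi=(h,f):M\to S^1\times W$ which restricts to a diffeomorphism from each fiber of $\pi$ onto $S^1\times W$. Through each $x\in M$ pass the circle $S^1_x=\{y:\pi(y)=\pi(x),\,f(y)=f(x)\}$ and the fiber $W_x=\{y:\pi(y)=\pi(x),\,h(y)=h(x)\}$; the horizontal space $H_x$ is the $g$-orthogonal of $T_x(\pi^{-1}(\pi(x)))$. Assume that $g$ has signature $(-)$ on the circles $S^1_x$, $(+,\dots,+)$ on the fibers $W_x$ and $(-,+,+,+)$ on $H_x$. Let $Y$ be a smooth Killing vector field tangent to the circles $S^1_x$ with $g(Y,Y)=-1$, and let $F=\mathbf d(Y^\flat)$. *Conventions.* $G=\mathrm{Ric}-\tfrac12 S\,g$ is the Einstein curvature, where $S$ is the scalar curvature and $\mathrm{Ric}(v,w)=\mathrm{tr}\big(u\mapsto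 R(u,v)w\big)$ with $R(U,V)=[\nabla_U,\nabla_V]-\nabla_{[U,V]}$. Bivectors and bilinear forms are identified through $g$. For a 2-tensor $T$, $(\nabla\cdot T)_j=\nabla^iT_{ij}$, and ${}^eT$ is the endomorphism with $g(u,{}^eT(v))=T(u,v)$. The exterior derivative satisfies $\mathbf d\omega(U,V)=U(\omega(V))-V(\omega(U))-\omega([U,V])$. *Charged dust.* Let $\Omega\subset M$ be open and suppose that on $\Omega$, for smooth functions $\mu,\alpha,e,\gamma$ with $\mu>0$ and smooth vector fields $X,X_0$, $$G=\mu X\otimes X+\alpha\,Y\otimes Y=\mu X_0\otimes X_0+e(X_0\otimes Y+Y\otimes X_0)+\gamma\,Y\otimes Y,$$ where $X=X_0+\frac e\mu Y$, $g(X_0,X_0)=-1$, $X_0\perp Y$, and at each point $X_0=\mathrm{pr}_H(X)$ is a basis of the eigenspace of ${}^eG_H=\mathrm{pr}_H\circ{}^eG|_H$ of eigenvalue $-\mu$. *Conclusion.* On $\Omega$ the following hold. 1. Conservation laws: $X_0\!\left(\frac e\mu\right)=\nabla\cdot(\mu X_0)=\nabla\cdot(eX_0)=0$. 2. Maxwell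 equations: $\mathbf dF=0$ and $(\nabla\cdot F)^\sharp=2e\,X_0+(2\gamma-S)\,Y$. 3. Free fall: $X=X_0+\frac e\mu Y$ is geodesic, $\nabla_XX=0$. 4. Lorentz equation: $\mu\nabla_{X_0}X_0=e\;{}^eF(X_0)$. Moreover $\nabla_{X_0}X_0\perp Y$, and $\mu\nabla_XX=\mu\nabla_{X_0}X_0-e\;{}^eF(X_0)$, so that free fall for $X$ is the Lorentz equation for $X_0$. -/

import Mathlib

open scoped Manifold ContDiff
open Bundle VectorField

noncomputable section

/-! ### Semi-Riemannian geometry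

`M` is a smooth manifold of dimension `n`, without boundary. Tensors at a point are built as
multilinear maps on the tangent space; vector fields are sections of the tangent bundle. -/

section SemiRiemannian

variable {n : ℕ} {M : Type*} [TopologicalSpace M] [ChartedSpace (EuclideanSpace ℝ (Fin n)) M]

/-- Tangent space of an `n`-dimensional manifold. -/
abbrev Tan (n : ℕ) {M : Type*} [TopologicalSpace M] [ChartedSpace (EuclideanSpace ℝ (Fin n)) M]
    (x : M) : Type :=
  TangentSpace (𝓡 n) x

variable [IsManifold (𝓡 n) ∞ M]

/-- The vector field `V` is smooth at (hence near) `x`. -/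
def SmoothFieldAt (V : ∀ x : M, Tan n x) (x : M) : Prop :=
  ContMDiffAt (𝓡 n) (𝓡 n).tangent ∞ (fun y => (⟨y, V y⟩ : TangentBundle (𝓡 n) M)) x

/-- The vector field `V` is smooth on the set `s`. -/
def SmoothFieldOn (V : ∀ x : M, Tan n x) (s : Set M) : Prop :=
  ContMDiffOn (𝓡 n) (𝓡 n).tangent ∞ (fun y => (⟨y, V y⟩ : TangentBundle (𝓡 n) M)) s

/-- The derivative `V(f)` of the function `f` along the vector field `V`. -/
def dirDeriv (V : ∀ x : M, Tan n x) (f : M → ℝ) (x : M) : ℝ :=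
  mvfderiv (𝓡 n) f x (V x)

/-- A smooth semi-Riemannian metric: a smooth field of nondegenerate symmetric bilinear forms on
the tangent spaces. -/
structure SemiRiemannianMetric (n : ℕ) (M : Type*) [TopologicalSpace M]
    [ChartedSpace (EuclideanSpace ℝ (Fin n)) M] [IsManifold (𝓡 n) ∞ M] where
  inner : ∀ x : M, Tan n x →L[ℝ] Tan n x →L[ℝ] ℝ
  symm : ∀ (x : M) (u v : Tan n x), inner x u v = inner x v u
  nondegenerate : ∀ (x : M) (u : Tan n x), (∀ v, inner x u v = 0) → u = 0
  contMDiff : ContMDiff (𝓡 n)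
    ((𝓡 n).prod 𝓘(ℝ, EuclideanSpace ℝ (Fin n) →L[ℝ] EuclideanSpace ℝ (Fin n) →L[ℝ] ℝ)) ∞
    (fun x => TotalSpace.mk' (EuclideanSpace ℝ (Fin n) →L[ℝ] EuclideanSpace ℝ (Fin n) →L[ℝ] ℝ)
      (E := fun x : M => TangentSpace (𝓡 n) x →L[ℝ] TangentSpace (𝓡 n) x →L[ℝ] ℝ) x (inner x))

instance (x : M) : FiniteDimensional ℝ (Tan n x) :=
  inferInstanceAs (FiniteDimensional ℝ (EuclideanSpace ℝ (Fin n)))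

namespace SemiRiemannianMetric

variable (g : SemiRiemannianMetric n M)

/-- The metric at `x` as a bilinear form. -/
def form (x : M) : LinearMap.BilinForm ℝ (Tan n x) :=
  LinearMap.mk₂ ℝ (fun u v => g.inner x u v) (by simp) (by simp) (by simp) (by simp)

theorem form_nondegenerate (x : M) : (g.form x).Nondegenerate := by
  refine ⟨fun u hu => g.nondegenerate x u hu, fun u hu => g.nondegenerate x u fun v => ?_⟩
  rw [g.symm]
  exact hu v

/-- The function `g(U, V)`. -/
def innerFields (U V : ∀ x : M, Tan n x) (x : M) : ℝ := g.inner x (U x) (V x)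

/-- The vector `η♯` with `g(η♯, v) = η(v)`. -/
def sharp (x : M) (η : Module.Dual ℝ (Tan n x)) : Tan n x :=
  ((g.form x).toDual (g.form_nondegenerate x)).symm η

/-- The endomorphism `ᵉB` associated with the bilinear form `B`: `g(u, ᵉB v) = B(u, v)`. -/
def endo (x : M) (B : LinearMap.BilinForm ℝ (Tan n x)) : Tan n x →ₗ[ℝ] Tan n x :=
  LinearMap.BilinForm.symmCompOfNondegenerate B.flip (g.form x) (g.form_nondegenerate x)

theorem inner_sharp (x : M) (η : Module.Dual ℝ (Tan n x)) (v : Tan n x) :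
    g.inner x (g.sharp x η) v = η v :=
  LinearMap.BilinForm.apply_toDual_symm_apply (hB := g.form_nondegenerate x) η v

theorem inner_endo (x : M) (B : LinearMap.BilinForm ℝ (Tan n x)) (u v : Tan n x) :
    g.inner x u (g.endo x B v) = B u v := by
  rw [g.symm]
  exact LinearMap.BilinForm.symmCompOfNondegenerate_left_apply B.flip (g.form_nondegenerate x) u v

/-- The trace of a bilinear form with respect to the metric, `g^{ij} B_{ij}`. -/
def metricTrace (x : M) (B : LinearMap.BilinForm ℝ (Tan n x)) : ℝ :=
  LinearMap.trace ℝ (Tan n x) (g.endo x B)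

theorem metricTrace_add (x : M) (B B' : LinearMap.BilinForm ℝ (Tan n x)) :
    g.metricTrace x (B + B') = g.metricTrace x B + g.metricTrace x B' := by
  have h : g.endo x (B + B') = g.endo x B + g.endo x B' := by
    ext1 v
    refine sub_eq_zero.mp (g.nondegenerate x _ fun u => ?_)
    rw [g.symm, map_sub, LinearMap.add_apply, map_add, inner_endo, inner_endo, inner_endo]
    simp
  rw [metricTrace, h, map_add]; rfl

theorem metricTrace_smul (x : M) (c : ℝ) (B : LinearMap.BilinForm ℝ (Tan n x)) :
    g.metricTrace x (c • B) = c * g.metricTrace x B := by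
  have h : g.endo x (c • B) = c • g.endo x B := by
    ext1 v
    refine sub_eq_zero.mp (g.nondegenerate x _ fun u => ?_)
    rw [g.symm, map_sub, LinearMap.smul_apply, map_smul, inner_endo, inner_endo]
    simp
  rw [metricTrace, h, map_smul]; rfl

/-- The right-hand side of the Koszul formula, i.e. `g(∇_U V, W)`. -/
def koszul (U V W : ∀ x : M, Tan n x) (x : M) : ℝ :=
  (dirDeriv U (g.innerFields V W) x + dirDeriv V (g.innerFields W U) x
    - dirDeriv W (g.innerFields U V) x
    + g.inner x (mlieBracket (𝓡 n) U V x) (W x) - g.inner x (mlieBracket (𝓡 n) U W x) (V x)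
    - g.inner x (mlieBracket (𝓡 n) V W x) (U x)) / 2

/-- The Levi-Civita connection: for a vector field `V` smooth at `x`, `g.nabla V x` is the linear
map `u ↦ ∇_u V` on the tangent space at `x`, that is the unique linear map that satisfies the
Koszul formula. The argument order is that of `CovariantDerivative` in Mathlib. -/
def nabla (V : ∀ x : M, Tan n x) (x : M) : Tan n x →ₗ[ℝ] Tan n x :=
  Classical.epsilon fun A : Tan n x →ₗ[ℝ] Tan n x =>
    ∀ U W : ∀ y : M, Tan n y, SmoothFieldAt U x → SmoothFieldAt W x →
      g.inner x (A (U x)) (W x) = g.koszul U V W x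

/-- The vector field `∇_U V`. -/
def nablaField (U V : ∀ x : M, Tan n x) (x : M) : Tan n x := g.nabla V x (U x)

/-- The curvature operator `R(U,V)W = ∇_U ∇_V W - ∇_V ∇_U W - ∇_[U,V] W` on vector fields. -/
def curvatureField (U V W : ∀ x : M, Tan n x) (x : M) : Tan n x :=
  g.nablaField U (g.nablaField V W) x - g.nablaField V (g.nablaField U W) x
    - g.nablaField (mlieBracket (𝓡 n) U V) W x

/-- The Riemann curvature tensor at `x`: the unique trilinear map which gives the curvature
operator on vector fields smooth at `x`. -/
def riemann (x : M) : Tan n x →ₗ[ℝ] Tan n x →ₗ[ℝ] Tan n x →ₗ[ℝ] Tan n x :=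
  Classical.epsilon fun R : Tan n x →ₗ[ℝ] Tan n x →ₗ[ℝ] Tan n x →ₗ[ℝ] Tan n x =>
    ∀ U V W : ∀ y : M, Tan n y, SmoothFieldAt U x → SmoothFieldAt V x → SmoothFieldAt W x →
      R (U x) (V x) (W x) = g.curvatureField U V W x

/-- The Ricci curvature `Ric(v, w) = tr (u ↦ R(u, v)w)`. -/
def ricci (x : M) : LinearMap.BilinForm ℝ (Tan n x) :=
  LinearMap.mk₂ ℝ
    (fun v w => LinearMap.trace ℝ (Tan n x)
      (((g.riemann x).flip v).flip w))
    (fun _ _ _ => by rw [← map_add]; congr 1; ext; simp)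
    (fun _ _ _ => by rw [← map_smul]; congr 1; ext; simp)
    (fun _ _ _ => by rw [← map_add]; congr 1; ext; simp)
    (fun _ _ _ => by rw [← map_smul]; congr 1; ext; simp)

/-- The scalar curvature. -/
def scalarCurvature (x : M) : ℝ := g.metricTrace x (g.ricci x)

/-- The Einstein curvature `G = Ric - (1/2) S g`. -/
def einstein (x : M) : LinearMap.BilinForm ℝ (Tan n x) :=
  g.ricci x - (g.scalarCurvature x / 2) • g.form x

/-- The divergence of a vector field, `∇·V = tr (u ↦ ∇_u V)`. -/
def div (V : ∀ x : M, Tan n x) (x : M) : ℝ :=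
  LinearMap.trace ℝ (Tan n x) (g.nabla V x)

/-- The covariant derivative of a field `T` of bilinear forms: `g.nablaForm T x u v w` is
`(∇_u T)(v, w)`, where `(∇_U T)(V, W) = U(T(V, W)) - T(∇_U V, W) - T(V, ∇_U W)`. -/
def nablaForm (T : ∀ x : M, LinearMap.BilinForm ℝ (Tan n x)) (x : M) :
    Tan n x →ₗ[ℝ] Tan n x →ₗ[ℝ] Tan n x →ₗ[ℝ] ℝ :=
  Classical.epsilon fun D : Tan n x →ₗ[ℝ] Tan n x →ₗ[ℝ] Tan n x →ₗ[ℝ] ℝ =>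
    ∀ U V W : ∀ y : M, Tan n y, SmoothFieldAt U x → SmoothFieldAt V x → SmoothFieldAt W x →
      D (U x) (V x) (W x) = dirDeriv U (fun y => T y (V y) (W y)) x
        - T x (g.nablaField U V x) (W x) - T x (V x) (g.nablaField U W x)

/-- For a trilinear form `D` and a vector `w`, the bilinear form `(u, v) ↦ D(u, v, w)`. -/
def lastSlot {x : M} (D : Tan n x →ₗ[ℝ] Tan n x →ₗ[ℝ] Tan n x →ₗ[ℝ] ℝ) (w : Tan n x) :
    LinearMap.BilinForm ℝ (Tan n x) :=
  LinearMap.mk₂ ℝ (fun u v => D u v w) (by simp) (by simp) (by simp) (by simp)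

/-- The divergence of a field of bilinear forms as a 1-form, `(∇·T)_j = ∇^i T_{ij}`. -/
def divForm (T : ∀ x : M, LinearMap.BilinForm ℝ (Tan n x)) (x : M) : Module.Dual ℝ (Tan n x) where
  toFun w := g.metricTrace x (lastSlot (g.nablaForm T x) w)
  map_add' w w' := by
    have h : lastSlot (g.nablaForm T x) (w + w')
        = lastSlot (g.nablaForm T x) w + lastSlot (g.nablaForm T x) w' := by
      ext u v; simp [lastSlot]
    rw [h, metricTrace_add]
  map_smul' c w := by
    have h : lastSlot (g.nablaForm T x) (c • w) = c • lastSlot (g.nablaForm T x) w := by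
      ext u v; simp [lastSlot]
    rw [h, metricTrace_smul]; rfl

/-- `Y` is a Killing vector field: the Lie derivative of the metric along `Y` vanishes. -/
def IsKilling (Y : ∀ x : M, Tan n x) : Prop :=
  ∀ (x : M) (U V : ∀ y : M, Tan n y), SmoothFieldAt U x → SmoothFieldAt V x →
    dirDeriv Y (g.innerFields U V) x
      = g.inner x (mlieBracket (𝓡 n) Y U x) (V x) + g.inner x (U x) (mlieBracket (𝓡 n) Y V x)

end SemiRiemannianMetric

/-- The exterior derivative of a 1-form: the unique bilinear map with
`dη(U, V) = U(η(V)) - V(η(U)) - η([U, V])` for vector fields smooth at `x`. -/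
def extDerivOne (η : ∀ x : M, Module.Dual ℝ (Tan n x)) (x : M) :
    LinearMap.BilinForm ℝ (Tan n x) :=
  Classical.epsilon fun A : LinearMap.BilinForm ℝ (Tan n x) =>
    ∀ U V : ∀ y : M, Tan n y, SmoothFieldAt U x → SmoothFieldAt V x →
      A (U x) (V x) = dirDeriv U (fun y => η y (V y)) x - dirDeriv V (fun y => η y (U y)) x
        - η x (mlieBracket (𝓡 n) U V x)

/-- The exterior derivative of a 2-form: the unique trilinear map given on vector fields smooth
at `x` by the invariant formula. -/
def extDerivTwo (F : ∀ x : M, LinearMap.BilinForm ℝ (Tan n x)) (x : M) :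
    Tan n x →ₗ[ℝ] Tan n x →ₗ[ℝ] Tan n x →ₗ[ℝ] ℝ :=
  Classical.epsilon fun A : Tan n x →ₗ[ℝ] Tan n x →ₗ[ℝ] Tan n x →ₗ[ℝ] ℝ =>
    ∀ U V W : ∀ y : M, Tan n y, SmoothFieldAt U x → SmoothFieldAt V x → SmoothFieldAt W x →
      A (U x) (V x) (W x) =
        dirDeriv U (fun y => F y (V y) (W y)) x - dirDeriv V (fun y => F y (U y) (W y)) x
          + dirDeriv W (fun y => F y (U y) (V y)) x
          - F x (mlieBracket (𝓡 n) U V x) (W x) + F x (mlieBracket (𝓡 n) U W x) (V x)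
          - F x (mlieBracket (𝓡 n) V W x) (U x)

end SemiRiemannian

/-! ### Multi-fiber bundles with fibers `(S¹, W)` -/

section MultiFiber

/-- An `(S¹, W)`-multi-fiber bundle structure on a manifold `M` of dimension `5 + m` over a manifold
`B` of dimension `4`, where `dim W = m`: a smooth fibration `proj : M → B` (written `π`) with fiber `S¹ × W`,
together with a smooth map `Φ = (h, f) : M → S¹ × W` whose restriction to each fiber of `π` is a
diffeomorphism onto `S¹ × W`. The latter is expressed by reading the restriction of `Φ` in a local
trivialization `τ` of `π`, which identifies the fiber over `b'` with `S¹ × W`. -/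
structure MultiFiberBundle (m : ℕ) (M B W : Type*)
    [TopologicalSpace M] [ChartedSpace (EuclideanSpace ℝ (Fin (5 + m))) M]
    [TopologicalSpace B] [ChartedSpace (EuclideanSpace ℝ (Fin 4)) B]
    [TopologicalSpace W] [ChartedSpace (EuclideanSpace ℝ (Fin m)) W] where
  proj : M → B
  h : M → Circle
  f : M → W
  smooth_proj : ContMDiff (𝓡 (5 + m)) (𝓡 4) ∞ proj
  smooth_h : ContMDiff (𝓡 (5 + m)) (𝓡 1) ∞ h
  smooth_f : ContMDiff (𝓡 (5 + m)) (𝓡 m) ∞ f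
  locally_trivial : ∀ b : B, ∃ τ : Trivialization (Circle × W) proj, b ∈ τ.baseSet ∧
    ContMDiffOn (𝓡 (5 + m)) ((𝓡 4).prod ((𝓡 1).prod (𝓡 m))) ∞ τ τ.source ∧
    ContMDiffOn ((𝓡 4).prod ((𝓡 1).prod (𝓡 m))) (𝓡 (5 + m)) ∞ τ.toOpenPartialHomeomorph.symm
      τ.target ∧
    ∀ b' ∈ τ.baseSet,
      ∃ d : Diffeomorph ((𝓡 1).prod (𝓡 m)) ((𝓡 1).prod (𝓡 m)) (Circle × W) (Circle × W) ∞,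
        ∀ s : Circle × W,
          d s = (h (τ.toOpenPartialHomeomorph.symm (b', s)),
            f (τ.toOpenPartialHomeomorph.symm (b', s)))

variable {m : ℕ} {M B W : Type*}
  [TopologicalSpace M] [ChartedSpace (EuclideanSpace ℝ (Fin (5 + m))) M]
  [TopologicalSpace B] [ChartedSpace (EuclideanSpace ℝ (Fin 4)) B]
  [TopologicalSpace W] [ChartedSpace (EuclideanSpace ℝ (Fin m)) W]

namespace MultiFiberBundle

variable (P : MultiFiberBundle m M B W)

/-- The tangent space at `x` to the whole fiber `π⁻¹(π(x))`. -/
def vertical (x : M) : Submodule ℝ (Tan (5 + m) x) :=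
  (mfderiv (𝓡 (5 + m)) (𝓡 4) P.proj x).toLinearMap.ker

/-- The tangent space at `x` to the circle `S¹_x = {y | π(y) = π(x), f(y) = f(x)}`. -/
def circleTangent (x : M) : Submodule ℝ (Tan (5 + m) x) :=
  P.vertical x ⊓ (mfderiv (𝓡 (5 + m)) (𝓡 m) P.f x).toLinearMap.ker

/-- The tangent space at `x` to the fiber `W_x = {y | π(y) = π(x), h(y) = h(x)}`. -/
def wTangent (x : M) : Submodule ℝ (Tan (5 + m) x) :=
  P.vertical x ⊓ (mfderiv (𝓡 (5 + m)) (𝓡 1) P.h x).toLinearMap.ker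

variable [IsManifold (𝓡 (5 + m)) ∞ M] (g : SemiRiemannianMetric (5 + m) M)

/-- The horizontal space at `x`: the `g`-orthogonal of the tangent space to the fiber of `π`. -/
def horizontal (x : M) : Submodule ℝ (Tan (5 + m) x) :=
  (P.vertical x).orthogonalBilin (g.form x)

/-- Compatibility of the metric with the multi-fiber structure: its signature is `(-)` on the
circles, `(+, …, +)` on the fibers `W_x` and `(-, +, +, +)` on the horizontal spaces. -/
structure IsCompatible : Prop where
  circle_neg : ∀ (x : M), ∀ u ∈ P.circleTangent x, u ≠ 0 → g.inner x u u < 0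
  w_pos : ∀ (x : M), ∀ u ∈ P.wTangent x, u ≠ 0 → 0 < g.inner x u u
  horizontal_lorentz : ∀ x : M, ∃ t ∈ P.horizontal g x, g.inner x t t < 0 ∧
    ∀ v ∈ P.horizontal g x, g.inner x t v = 0 → v ≠ 0 → 0 < g.inner x v v

/-- `Y` is an electromagnetic potential: a smooth vector field tangent to the circles `S¹_x`, with
`g(Y, Y) = -1`. (Its sign is fixed by the choice of an orientation of `S¹`.) -/
structure IsPotential (Y : ∀ x : M, Tan (5 + m) x) : Prop where
  smooth : SmoothFieldOn Y Set.univ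
  tangent : ∀ x : M, Y x ∈ P.circleTangent x
  unit : ∀ x : M, g.inner x (Y x) (Y x) = -1

end MultiFiberBundle

/-- The electromagnetic field `F = d(Y♭)`. -/
def emField {n : ℕ} {M : Type*} [TopologicalSpace M] [ChartedSpace (EuclideanSpace ℝ (Fin n)) M]
    [IsManifold (𝓡 n) ∞ M] (g : SemiRiemannianMetric n M) (Y : ∀ x : M, Tan n x) :
    ∀ x : M, LinearMap.BilinForm ℝ (Tan n x) :=
  extDerivOne fun x => g.form x (Y x)

/-- `Ω` is a domain of charged dust: the Einstein curvature is `μ X ⊗ X + α Y ⊗ Y` on `Ω`, where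
the orthogonal projection `X₀` of `X` to the horizontal space spans a timelike eigenspace of the
endomorphism `ᵉG_H` of the horizontal space, of eigenvalue `-μ < 0`; and `X₀`, `μ`, `e`, `γ` are the
associated classical data, that is `G = μ X₀ ⊗ X₀ + e (X₀ ⊗ Y + Y ⊗ X₀) + γ Y ⊗ Y` with
`g(X₀, X₀) = -1`, `X₀ ⊥ Y` and `X = X₀ + (e / μ) Y`. -/
structure IsChargedDust [IsManifold (𝓡 (5 + m)) ∞ M] (P : MultiFiberBundle m M B W)
    (g : SemiRiemannianMetric (5 + m) M) (Y : ∀ x : M, Tan (5 + m) x) (Ω : Set M)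
    (μ α e γ : M → ℝ) (X X₀ : ∀ x : M, Tan (5 + m) x) : Prop where
  isOpen : IsOpen Ω
  smooth_μ : ContMDiffOn (𝓡 (5 + m)) 𝓘(ℝ, ℝ) ∞ μ Ω
  smooth_α : ContMDiffOn (𝓡 (5 + m)) 𝓘(ℝ, ℝ) ∞ α Ω
  smooth_e : ContMDiffOn (𝓡 (5 + m)) 𝓘(ℝ, ℝ) ∞ e Ω
  smooth_γ : ContMDiffOn (𝓡 (5 + m)) 𝓘(ℝ, ℝ) ∞ γ Ω
  smooth_X : SmoothFieldOn X Ω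
  smooth_X₀ : SmoothFieldOn X₀ Ω
  einstein_eq : ∀ x ∈ Ω, ∀ u v : Tan (5 + m) x, g.einstein x u v =
    μ x * (g.inner x (X x) u * g.inner x (X x) v) + α x * (g.inner x (Y x) u * g.inner x (Y x) v)
  projection : ∀ x ∈ Ω, X₀ x ∈ P.horizontal g x ∧ X x - X₀ x ∈ P.vertical x
  eigenspace : ∀ x ∈ Ω, ∀ v ∈ P.horizontal g x,
    (∀ u ∈ P.horizontal g x, g.einstein x u v = -μ x * g.inner x u v) ↔ ∃ c : ℝ, v = c • X₀ x
  mass_pos : ∀ x ∈ Ω, 0 < μ x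
  unit : ∀ x ∈ Ω, g.inner x (X₀ x) (X₀ x) = -1
  orthogonal : ∀ x ∈ Ω, g.inner x (X₀ x) (Y x) = 0
  einstein_eq_classical : ∀ x ∈ Ω, ∀ u v : Tan (5 + m) x, g.einstein x u v =
    μ x * (g.inner x (X₀ x) u * g.inner x (X₀ x) v)
      + e x * (g.inner x (X₀ x) u * g.inner x (Y x) v + g.inner x (Y x) u * g.inner x (X₀ x) v)
      + γ x * (g.inner x (Y x) u * g.inner x (Y x) v)
  field_eq : ∀ x ∈ Ω, X x = X₀ x + (e x / μ x) • Y x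

end MultiFiber

end

/-!
The statement is local, so it is proved for germs at a point of `Ω`. The germs of smooth vector
fields are a free module over the ring `A` of germs of smooth functions, act on `A` by derivations,
and carry a Lie bracket and a nondegenerate `A`-bilinear metric; the structure `MetricLieRinehart`
records exactly this (`germAlgebra`). The Koszul formula, the curvature, the Bianchi identity and
its contraction `act_scal`, and the theory of Killing fields are pure algebra in such a structure,
and so is the whole argument about charged dust (`MetricLieRinehart.IsDust`).

Write `y`, `x` for the germs of the potential `Y` and of the velocity `X₀`, and
`T = μ x ⊗ x + e (x ⊗ y + y ⊗ x) + γ y ⊗ y` for the Einstein tensor.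

* A Killing field preserves the connection (`IsKilling.br_nab`), hence curvature and `T`. Evaluating
  `ℒ_y T = 0` on `x` and `y` gives `y(μ) = y(e) = y(γ) = 0` and `[y, x] = 0` (`IsDust.br_y_x`).
* Besides, `div y = 0` and `∇_y y = 0`. With all this, `div T = 0` becomes
  `div(μx) x + μ ∇_x x + div(ex) y + 2e ∇_x y = 0` (`IsDust.divSecond_dustTensor`). Since `∇_x x`
  and `∇_x y` are orthogonal to `x` and `y`, the components along `x` and `y` are the two
  conservation laws, and `μ ∇_x x + 2e ∇_x y = 0` remains (`IsDust.lorentz`). The specific charge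
  `q = e / μ` is constant along `x` by the conservation laws and along `y` by invariance, whence
  `∇_{x + qy}(x + qy) = ∇_x x + 2q ∇_x y`, which vanishes (`IsDust.geodesic`). As
  `F = 2g(∇y, ·)` for a Killing field, `-2 ∇_x y` is the Lorentz force per unit charge
  (`IsKilling.endo_emField`).
* The second derivative of a Killing field is a curvature term (`IsKilling.curv_eq`), so that
  `∇·F = -2 Ric(y, ·)`, and the Einstein equation evaluates the right-hand side
  (`IsDust.maxwell`). `dF = 0` is the Jacobi identity (`dFlat_closed`).

It remains to identify the tensors on the manifold, which are defined by choice from their values on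
smooth fields, with their algebraic counterparts. An operation on germs that is linear over `A`
induces a tensor on the tangent space (`evalLin`), so that the tensors in question exist, and germs
compute them (`hasFieldGerm_nablaField`, `hasGerm_ricci`, `hasGerm_emField`, `divForm_emField`).
-/

noncomputable section

open scoped Topology

/-! ### Metrics on Lie–Rinehart algebras -/

/-- The algebra of germs of functions and vector fields on a semi-Riemannian manifold, abstractly:
a commutative ring `A`, an `A`-module `X` that acts on `A` by derivations and carries a Lie bracket
compatible with this action, and a symmetric bilinear form `g` on `X` for which the finite family
`frame` has a dual family `dual`. -/
structure MetricLieRinehart (A X ι : Type*) [CommRing A] [AddCommGroup X] [Module A X]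
    [Fintype ι] [DecidableEq ι] where
  act : X → A → A
  act_add_left : ∀ u v a, act (u + v) a = act u a + act v a
  act_smul_left : ∀ a u c, act (a • u) c = a * act u c
  act_add : ∀ u a c, act u (a + c) = act u a + act u c
  act_mul : ∀ u a c, act u (a * c) = act u a * c + a * act u c
  br : X → X → X
  br_skew : ∀ u v, br u v = - br v u
  br_add : ∀ u v w, br u (v + w) = br u v + br u w
  br_smul : ∀ u a v, br u (a • v) = act u a • v + a • br u v
  act_br : ∀ u v a, act (br u v) a = act u (act v a) - act v (act u a)
  jacobi : ∀ u v w, br u (br v w) = br (br u v) w + br v (br u w)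
  g : X →ₗ[A] X →ₗ[A] A
  g_symm : ∀ u v, g u v = g v u
  frame : ι → X
  dual : ι → X
  sum_frame : ∀ v, ∑ i, g v (dual i) • frame i = v
  g_frame_dual : ∀ i j, g (frame i) (dual j) = if i = j then 1 else 0

namespace MetricLieRinehart

variable {A X ι : Type*} [CommRing A] [AddCommGroup X] [Module A X] [Fintype ι] [DecidableEq ι]
  (L : MetricLieRinehart A X ι)

theorem act_zero (u : X) : L.act u 0 = 0 := by
  have h := L.act_add u 0 0
  rw [add_zero] at h
  exact left_eq_add.mp h

theorem act_one (u : X) : L.act u 1 = 0 := by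
  have h := L.act_mul u 1 1
  simp only [mul_one, one_mul] at h
  exact left_eq_add.mp h

theorem act_neg (u : X) (a : A) : L.act u (-a) = - L.act u a := by
  have h := L.act_add u a (-a)
  rw [add_neg_cancel, L.act_zero] at h
  exact eq_neg_of_add_eq_zero_right h.symm

theorem act_sub (u : X) (a c : A) : L.act u (a - c) = L.act u a - L.act u c := by
  rw [sub_eq_add_neg, L.act_add, L.act_neg, sub_eq_add_neg]

theorem act_sum {κ : Type*} (s : Finset κ) (u : X) (f : κ → A) :
    L.act u (∑ i ∈ s, f i) = ∑ i ∈ s, L.act u (f i) :=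
  map_sum (AddMonoidHom.mk' (L.act u) (L.act_add u)) f s

theorem act_two (u : X) : L.act u 2 = 0 := by
  rw [← one_add_one_eq_two, L.act_add, L.act_one, add_zero]

theorem br_zero (u : X) : L.br u 0 = 0 := by
  have h := L.br_add u 0 0
  rw [add_zero] at h
  exact left_eq_add.mp h

theorem br_neg (u v : X) : L.br u (-v) = - L.br u v := by
  have h := L.br_add u v (-v)
  rw [add_neg_cancel, L.br_zero] at h
  exact eq_neg_of_add_eq_zero_right h.symm

theorem br_sub (u v w : X) : L.br u (v - w) = L.br u v - L.br u w := by
  rw [sub_eq_add_neg, L.br_add, L.br_neg, sub_eq_add_neg]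

theorem add_br (u v w : X) : L.br (u + v) w = L.br u w + L.br v w := by
  rw [L.br_skew, L.br_add, L.br_skew u, L.br_skew v, neg_add]

theorem smul_br (a : A) (u v : X) : L.br (a • u) v = a • L.br u v - L.act v a • u := by
  rw [L.br_skew, L.br_smul, L.br_skew u, smul_neg]; abel

/-- The metric is nondegenerate, because the frame has a dual family. -/
theorem eq_of_g {u v : X} (h : ∀ w, L.g u w = L.g v w) : u = v := by
  rw [← L.sum_frame u, ← L.sum_frame v]
  simp only [h]

theorem sum_dual (v : X) : ∑ i, L.g v (L.frame i) • L.dual i = v := by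
  refine L.eq_of_g fun w => ?_
  conv_rhs => rw [L.g_symm, ← L.sum_frame w, L.g_symm]
  simp only [map_sum, LinearMap.sum_apply, map_smul, LinearMap.smul_apply, smul_eq_mul]
  refine Finset.sum_congr rfl fun i _ => ?_
  rw [L.g_symm (L.dual i) w, mul_comm]

/-- A sum over the frame and the dual frame does not depend on which of the two comes first. -/
theorem sum_frame_dual_comm (B : X →ₗ[A] X →ₗ[A] A) :
    ∑ i, B (L.frame i) (L.dual i) = ∑ i, B (L.dual i) (L.frame i) := by
  calc ∑ i, B (L.frame i) (L.dual i)
      = ∑ i, ∑ j, L.g (L.frame i) (L.frame j) * B (L.dual j) (L.dual i) := by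
        refine Finset.sum_congr rfl fun i _ => ?_
        conv_lhs => rw [← L.sum_dual (L.frame i)]
        simp only [map_sum, LinearMap.sum_apply, map_smul, LinearMap.smul_apply, smul_eq_mul]
    _ = ∑ j, ∑ i, L.g (L.frame j) (L.frame i) * B (L.dual j) (L.dual i) := by
        rw [Finset.sum_comm]
        exact Finset.sum_congr rfl fun i _ => Finset.sum_congr rfl fun j _ => by
          rw [L.g_symm (L.frame j)]
    _ = _ := by
        refine Finset.sum_congr rfl fun j _ => ?_
        conv_rhs => rw [← L.sum_dual (L.frame j)]
        simp only [map_sum, map_smul, smul_eq_mul]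

/-- A metric derivation does not change the canonical element `∑ᵢ frame i ⊗ dual i`: this is why
contractions commute with covariant derivatives and with Lie derivatives along Killing fields. -/
theorem sum_derivation_eq_zero {d : A → A} {δ : X → X} (hd0 : d 0 = 0) (hd1 : d 1 = 0)
    (hδ : ∀ u v, d (L.g u v) = L.g (δ u) v + L.g u (δ v)) (B : X →ₗ[A] X →ₗ[A] A) :
    ∑ i, (B (δ (L.frame i)) (L.dual i) + B (L.frame i) (δ (L.dual i))) = 0 := by
  have h1 : ∀ i, B (δ (L.frame i)) (L.dual i)
      = ∑ j, L.g (δ (L.frame i)) (L.dual j) * B (L.frame j) (L.dual i) := fun i => by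
    conv_lhs => rw [← L.sum_frame (δ (L.frame i))]
    simp only [map_sum, LinearMap.sum_apply, map_smul, LinearMap.smul_apply, smul_eq_mul]
  have h2 : ∀ i, B (L.frame i) (δ (L.dual i))
      = ∑ j, L.g (δ (L.dual i)) (L.frame j) * B (L.frame i) (L.dual j) := fun i => by
    conv_lhs => rw [← L.sum_dual (δ (L.dual i))]
    simp only [map_sum, map_smul, smul_eq_mul]
  simp only [h1, h2, Finset.sum_add_distrib]
  rw [Finset.sum_comm (f := fun i j => L.g (δ (L.dual i)) (L.frame j) * B (L.frame i) (L.dual j)),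
    ← Finset.sum_add_distrib]
  refine Finset.sum_eq_zero fun i _ => ?_
  rw [← Finset.sum_add_distrib]
  refine Finset.sum_eq_zero fun j _ => ?_
  rw [← add_mul, L.g_symm (δ (L.dual j)), ← hδ, L.g_frame_dual]
  split_ifs <;> simp [hd0, hd1]

/-! ### The Levi-Civita connection -/

/-- The right-hand side of the Koszul formula, `2 g(∇_u v, w)`. -/
def kos (u v w : X) : A :=
  L.act u (L.g v w) + L.act v (L.g w u) - L.act w (L.g u v)
    + L.g (L.br u v) w - L.g (L.br u w) v - L.g (L.br v w) u

theorem kos_add_right (u v w w' : X) : L.kos u v (w + w') = L.kos u v w + L.kos u v w' := by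
  simp only [kos, map_add, LinearMap.add_apply, L.br_add, L.act_add, L.act_add_left]
  ring

theorem kos_smul_right (u v : X) (a : A) (w : X) : L.kos u v (a • w) = a * L.kos u v w := by
  simp only [kos, map_add, map_smul, LinearMap.add_apply, LinearMap.smul_apply, smul_eq_mul,
    L.br_smul, L.act_mul, L.act_smul_left]
  linear_combination L.act u a * L.g_symm v w

theorem kos_add_left (u u' v w : X) : L.kos (u + u') v w = L.kos u v w + L.kos u' v w := by
  simp only [kos, map_add, LinearMap.add_apply, L.add_br, L.act_add, L.act_add_left]
  ring

theorem kos_smul_left (a : A) (u v w : X) : L.kos (a • u) v w = a * L.kos u v w := by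
  simp only [kos, map_sub, map_smul, LinearMap.sub_apply, LinearMap.smul_apply, smul_eq_mul,
    L.smul_br, L.act_mul, L.act_smul_left]
  linear_combination L.act v a * L.g_symm w u

theorem kos_add_mid (u v v' w : X) : L.kos u (v + v') w = L.kos u v w + L.kos u v' w := by
  simp only [kos, map_add, LinearMap.add_apply, L.br_add, L.add_br, L.act_add, L.act_add_left]
  ring

/-- In its middle slot the Koszul form is a derivation rather than linear; this is the Leibniz rule
of the connection. -/
theorem kos_smul_mid (u : X) (a : A) (v w : X) :
    L.kos u (a • v) w = 2 * (L.act u a * L.g v w) + a * L.kos u v w := by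
  simp only [kos, map_sub, map_add, map_smul, LinearMap.sub_apply, LinearMap.add_apply,
    LinearMap.smul_apply, smul_eq_mul, L.br_smul, L.smul_br, L.act_mul, L.act_smul_left]
  linear_combination - L.act w a * L.g_symm u v

theorem kos_symm_add (u v w : X) : L.kos u v w + L.kos u w v = 2 * L.act u (L.g v w) := by
  simp only [kos, L.g_symm w v, L.g_symm u v, L.g_symm w u, L.br_skew w v, map_neg,
    LinearMap.neg_apply]
  ring

theorem kos_sub (u v w : X) : L.kos u v w - L.kos v u w = 2 * L.g (L.br u v) w := by
  simp only [kos, L.g_symm u w, L.g_symm u v, L.g_symm w v, L.br_skew v u, map_neg,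
    LinearMap.neg_apply]
  ring

variable [Invertible (2 : A)]

/-- The Levi-Civita connection `∇_u v`, defined by the Koszul formula. -/
def nab (u v : X) : X := ⅟(2 : A) • ∑ i, L.kos u v (L.dual i) • L.frame i

theorem two_cancel {a c : A} (h : 2 * a = 2 * c) : a = c :=
  (isUnit_of_invertible (2 : A)).mul_left_cancel h

/-- The defining property of the connection, which holds because the Koszul form is linear in its
last slot. -/
theorem g_nab (u v w : X) : 2 * L.g (L.nab u v) w = L.kos u v w := by
  have hlin : L.kos u v w = ∑ i, L.g w (L.frame i) * L.kos u v (L.dual i) := by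
    conv_lhs => rw [← L.sum_dual w]
    refine (map_sum (AddMonoidHom.mk' (L.kos u v) (L.kos_add_right u v)) _ _).trans ?_
    exact Finset.sum_congr rfl fun i _ => L.kos_smul_right u v _ _
  rw [hlin, nab, map_smul, LinearMap.smul_apply, smul_eq_mul, mul_invOf_cancel_left, map_sum,
    LinearMap.sum_apply]
  refine Finset.sum_congr rfl fun i _ => ?_
  rw [map_smul, LinearMap.smul_apply, smul_eq_mul, L.g_symm w, mul_comm]

theorem eq_of_two_g {u v : X} (h : ∀ w, 2 * L.g u w = 2 * L.g v w) : u = v :=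
  L.eq_of_g fun w => two_cancel (h w)

theorem add_nab (u u' v : X) : L.nab (u + u') v = L.nab u v + L.nab u' v :=
  L.eq_of_two_g fun w => by
    rw [L.g_nab, L.kos_add_left, map_add, LinearMap.add_apply, mul_add, L.g_nab, L.g_nab]

theorem smul_nab (a : A) (u v : X) : L.nab (a • u) v = a • L.nab u v :=
  L.eq_of_two_g fun w => by
    rw [L.g_nab, L.kos_smul_left, map_smul, LinearMap.smul_apply, smul_eq_mul, mul_left_comm,
      L.g_nab]

theorem nab_add (u v v' : X) : L.nab u (v + v') = L.nab u v + L.nab u v' :=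
  L.eq_of_two_g fun w => by
    rw [L.g_nab, L.kos_add_mid, map_add, LinearMap.add_apply, mul_add, L.g_nab, L.g_nab]

theorem nab_smul (u : X) (a : A) (v : X) : L.nab u (a • v) = L.act u a • v + a • L.nab u v :=
  L.eq_of_two_g fun w => by
    rw [L.g_nab, L.kos_smul_mid, map_add, map_smul, map_smul, LinearMap.add_apply,
      LinearMap.smul_apply, LinearMap.smul_apply, smul_eq_mul, smul_eq_mul, mul_add,
      mul_left_comm 2 a, L.g_nab]

/-- The Levi-Civita connection is metric. -/
theorem act_g (u v w : X) : L.act u (L.g v w) = L.g (L.nab u v) w + L.g v (L.nab u w) := by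
  refine two_cancel ?_
  rw [← L.kos_symm_add, mul_add, L.g_nab, L.g_symm v, L.g_nab]

/-- The Levi-Civita connection is torsion-free. -/
theorem nab_sub_nab (u v : X) : L.nab u v - L.nab v u = L.br u v :=
  L.eq_of_two_g fun w => by
    rw [← L.kos_sub, map_sub, LinearMap.sub_apply, mul_sub, L.g_nab, L.g_nab]

theorem nab_neg (u v : X) : L.nab u (-v) = - L.nab u v :=
  (AddMonoidHom.mk' (L.nab u) (L.nab_add u)).map_neg v

theorem nab_sub (u v w : X) : L.nab u (v - w) = L.nab u v - L.nab u w :=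
  (AddMonoidHom.mk' (L.nab u) (L.nab_add u)).map_sub v w

theorem neg_nab (u v : X) : L.nab (-u) v = - L.nab u v := by
  rw [← neg_one_smul A, L.smul_nab, neg_one_smul]

theorem sub_nab (u u' v : X) : L.nab (u - u') v = L.nab u v - L.nab u' v := by
  rw [sub_eq_add_neg, L.add_nab, L.neg_nab, sub_eq_add_neg]

theorem br_self (u : X) : L.br u u = 0 := by rw [← L.nab_sub_nab, sub_self]

/-! ### Curvature and the Bianchi identity -/

/-- The curvature operator `R(u, v)w`. -/
def curv (u v w : X) : X :=
  L.nab u (L.nab v w) - L.nab v (L.nab u w) - L.nab (L.br u v) w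

theorem curv_skew (u v w : X) : L.curv u v w = - L.curv v u w := by
  simp only [curv, L.br_skew v u, L.neg_nab]; abel

theorem curv_add (u v w w' : X) : L.curv u v (w + w') = L.curv u v w + L.curv u v w' := by
  simp only [curv, L.nab_add]; abel

theorem curv_smul (u v : X) (a : A) (w : X) : L.curv u v (a • w) = a • L.curv u v w := by
  simp only [curv, L.nab_smul, L.nab_add, L.act_br]; module

theorem add_curv (u u' v w : X) : L.curv (u + u') v w = L.curv u v w + L.curv u' v w := by
  simp only [curv, L.add_nab, L.nab_add, L.add_br]; abel

theorem smul_curv (a : A) (u v w : X) : L.curv (a • u) v w = a • L.curv u v w := by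
  simp only [curv, L.smul_nab, L.nab_smul, L.smul_br, L.sub_nab]; module

theorem curv_add_mid (u v v' w : X) : L.curv u (v + v') w = L.curv u v w + L.curv u v' w := by
  rw [L.curv_skew, L.add_curv, neg_add, ← L.curv_skew, ← L.curv_skew]

theorem curv_smul_mid (u : X) (a : A) (v w : X) : L.curv u (a • v) w = a • L.curv u v w := by
  rw [L.curv_skew, L.smul_curv, ← smul_neg, ← L.curv_skew]

/-- The endomorphism `R(u, v)` is skew-adjoint. -/
theorem g_curv (u v w z : X) : L.g (L.curv u v w) z = - L.g w (L.curv u v z) := by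
  have h := L.act_br u v (L.g w z)
  simp only [L.act_g, L.act_add] at h
  simp only [curv, map_sub, LinearMap.sub_apply]
  linear_combination -h

/-- The covariant derivative `(∇_z R)(u, v)w` of the curvature. -/
def nabCurv (z u v w : X) : X :=
  L.nab z (L.curv u v w) - L.curv (L.nab z u) v w - L.curv u (L.nab z v) w
    - L.curv u v (L.nab z w)

theorem nabCurv_skew (z u v w : X) : L.nabCurv z u v w = - L.nabCurv z v u w := by
  simp only [nabCurv, L.curv_skew u v, L.curv_skew (L.nab z u), L.curv_skew u, L.nab_neg]; abel

theorem g_nabCurv (z u v w t : X) :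
    L.g (L.nabCurv z u v w) t = - L.g w (L.nabCurv z u v t) := by
  have h := congrArg (L.act z) (L.g_curv u v w t)
  rw [L.act_neg, L.act_g, L.act_g] at h
  simp only [nabCurv, map_sub, LinearMap.sub_apply]
  linear_combination h - L.g_curv (L.nab z u) v w t - L.g_curv u (L.nab z v) w t
    - L.g_curv u v (L.nab z w) t - L.g_curv u v w (L.nab z t)

/-- The differential Bianchi identity. -/
theorem bianchi (z u v w : X) :
    L.nabCurv z u v w + L.nabCurv u v z w + L.nabCurv v z u w = 0 := by
  -- torsion-freeness turns the derivatives of the first two arguments into brackets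
  have key : ∀ p q r s : X, L.curv (L.nab p q) r s - L.curv (L.nab q p) r s
      = L.curv (L.br p q) r s := fun p q r s => by
    rw [← L.nab_sub_nab, sub_eq_add_neg (L.nab p q), L.add_curv, ← neg_one_smul A (L.nab q p),
      L.smul_curv, neg_one_smul, sub_eq_add_neg]
  -- the terms in which the bracket is iterated cancel by the Jacobi identity
  have hjac : L.nab (L.br (L.br z u) v) w + L.nab (L.br (L.br u v) z) w
      + L.nab (L.br (L.br v z) u) w = 0 := by
    rw [← L.add_nab, ← L.add_nab]
    have : L.br (L.br z u) v + L.br (L.br u v) z + L.br (L.br v z) u = 0 := by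
      have h := L.jacobi z u v
      rw [L.br_skew (L.br u v) z, L.br_skew (L.br v z) u, h, L.br_skew v z, L.br_neg]
      abel
    simpa [this] using L.sub_nab 0 0 w
  have e1 := key z u v w
  have e2 := key u v z w
  have e3 := key v z u w
  simp only [nabCurv, L.curv_skew u (L.nab z v), L.curv_skew v (L.nab u z),
    L.curv_skew z (L.nab v u)]
  have split : ∀ p q r : X, L.nab p (L.curv q r w) - L.curv q r (L.nab p w)
      = L.nab p (L.nab q (L.nab r w)) - L.nab p (L.nab r (L.nab q w))
        - L.nab p (L.nab (L.br q r) w)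
        - (L.nab q (L.nab r (L.nab p w)) - L.nab r (L.nab q (L.nab p w))
          - L.nab (L.br q r) (L.nab p w)) := fun p q r => by
    simp only [curv, L.nab_sub]
  have f1 := split z u v
  have f2 := split u v z
  have f3 := split v z u
  have c : ∀ p q r : X, L.curv (L.br p q) r w
      = L.nab (L.br p q) (L.nab r w) - L.nab r (L.nab (L.br p q) w)
        - L.nab (L.br (L.br p q) r) w := fun _ _ _ => rfl
  rw [c] at e1 e2 e3
  linear_combination (norm := abel) f1 + f2 + f3 - e1 - e2 - e3 + hjac

end MetricLieRinehart

namespace MetricLieRinehart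

variable {A X ι : Type*} [CommRing A] [AddCommGroup X] [Module A X] [Fintype ι] [DecidableEq ι]
  (L : MetricLieRinehart A X ι)

/-! ### Exterior derivatives of 1-forms -/

theorem act_eq_sum (z : X) (a : A) :
    L.act z a = ∑ i, L.g z (L.dual i) * L.act (L.frame i) a := by
  conv_lhs => rw [← L.sum_frame z]
  refine (map_sum (AddMonoidHom.mk' (fun u => L.act u a) fun u v => L.act_add_left u v a)
    _ _).trans ?_
  exact Finset.sum_congr rfl fun i _ => L.act_smul_left _ _ _

/-- The exterior derivative of the 1-form `g(y, ·)`. -/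
def dFlat (y u v : X) : A :=
  L.act u (L.g y v) - L.act v (L.g y u) - L.g y (L.br u v)

/-- The exterior derivative of `g(y, ·)` is closed. -/
theorem dFlat_closed (y u v w : X) :
    L.act u (L.dFlat y v w) - L.act v (L.dFlat y u w) + L.act w (L.dFlat y u v)
      - L.dFlat y (L.br u v) w + L.dFlat y (L.br u w) v - L.dFlat y (L.br v w) u = 0 := by
  have h := congrArg (L.g y) (L.jacobi u v w)
  rw [L.br_skew u (L.br v w), L.br_skew v (L.br u w)] at h
  simp only [map_add, map_neg] at h
  simp only [dFlat, L.act_sub, L.act_br]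
  linear_combination -h

/-! ### Ricci curvature and the contracted Bianchi identity -/

variable [Invertible (2 : A)]

/-- The bilinear form `(p, q) ↦ g(R(p, v)w, q)`, whose contraction is the Ricci curvature. -/
def curvForm (v w : X) : X →ₗ[A] X →ₗ[A] A :=
  LinearMap.mk₂ A (fun p q => L.g (L.curv p v w) q)
    (fun _ _ _ => by simp [L.add_curv]) (fun _ _ _ => by simp [L.smul_curv])
    (fun _ _ _ => by simp) (fun _ _ _ => by simp)

/-- The Ricci curvature. -/
def ric : X →ₗ[A] X →ₗ[A] A :=
  LinearMap.mk₂ A (fun v w => ∑ i, L.g (L.curv (L.frame i) v w) (L.dual i))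
    (fun _ _ _ => by simp [L.curv_add_mid, Finset.sum_add_distrib])
    (fun _ _ _ => by simp [L.curv_smul_mid, Finset.mul_sum])
    (fun _ _ _ => by simp [L.curv_add, Finset.sum_add_distrib])
    (fun _ _ _ => by simp [L.curv_smul, Finset.mul_sum])

theorem ric_apply (v w : X) :
    L.ric v w = ∑ i, L.g (L.curv (L.frame i) v w) (L.dual i) := rfl

/-- The scalar curvature. -/
def scal : A := ∑ i, L.ric (L.frame i) (L.dual i)

/-- The covariant derivative `(∇_z T)(v, w)`. -/
def nabForm (T : X → X → A) (z v w : X) : A :=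
  L.act z (T v w) - T (L.nab z v) w - T v (L.nab z w)

/-- The divergence of the vector field `v`. -/
def div (v : X) : A := ∑ i, L.g (L.nab (L.frame i) v) (L.dual i)

/-- The divergence in the second slot of the covariant tensor `T`. -/
def divSecond (T : X → X → A) (z : X) : A := ∑ i, L.nabForm T (L.frame i) z (L.dual i)

/-- Covariant derivatives commute with the contraction that defines the Ricci curvature. -/
theorem nabForm_ric (z v w : X) :
    L.nabForm (fun p q => L.ric p q) z v w
      = ∑ i, L.g (L.nabCurv z (L.frame i) v w) (L.dual i) := by
  have h := L.sum_derivation_eq_zero (L.act_zero z) (L.act_one z) (L.act_g z) (L.curvForm v w)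
  simp only [curvForm, LinearMap.mk₂_apply] at h
  simp only [nabForm, ric_apply, L.act_sum, L.act_g, nabCurv, map_sub, LinearMap.sub_apply,
    Finset.sum_sub_distrib, Finset.sum_add_distrib] at h ⊢
  linear_combination h

theorem sum_nabForm_ric (z : X) :
    ∑ j, L.nabForm (fun p q => L.ric p q) z (L.frame j) (L.dual j) = L.act z L.scal := by
  have h := L.sum_derivation_eq_zero (L.act_zero z) (L.act_one z) (L.act_g z) L.ric
  simp only [nabForm, scal, L.act_sum, Finset.sum_sub_distrib, Finset.sum_add_distrib] at h ⊢
  linear_combination -h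

/-- The contracted Bianchi identity. -/
theorem act_scal (z : X) : L.act z L.scal = 2 * L.divSecond (fun p q => L.ric p q) z := by
  -- the Bianchi identity contracted once
  have hb : ∀ v w, L.nabForm (fun p q => L.ric p q) z v w
      + ∑ i, L.g (L.nabCurv (L.frame i) v z w) (L.dual i)
      - L.nabForm (fun p q => L.ric p q) v z w = 0 := fun v w => by
    rw [L.nabForm_ric, L.nabForm_ric, ← Finset.sum_add_distrib, ← Finset.sum_sub_distrib]
    refine Finset.sum_eq_zero fun i _ => ?_
    have h := congrArg (fun t => L.g t (L.dual i)) (L.bianchi z (L.frame i) v w)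
    simp only [map_add, LinearMap.add_apply, L.nabCurv_skew v z, map_neg, LinearMap.neg_apply,
      map_zero, LinearMap.zero_apply] at h
    linear_combination h
  -- a second contraction
  have hs : ∑ j, (L.nabForm (fun p q => L.ric p q) z (L.frame j) (L.dual j)
      + ∑ i, L.g (L.nabCurv (L.frame i) (L.frame j) z (L.dual j)) (L.dual i)
      - L.nabForm (fun p q => L.ric p q) (L.frame j) z (L.dual j)) = 0 :=
    Finset.sum_eq_zero fun j _ => hb _ _
  -- the middle term is again a divergence, since `R(u, v)` is skew-adjoint
  have hd : ∑ j, ∑ i, L.g (L.nabCurv (L.frame i) (L.frame j) z (L.dual j)) (L.dual i)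
      = - L.divSecond (fun p q => L.ric p q) z := by
    rw [Finset.sum_comm, divSecond, ← Finset.sum_neg_distrib]
    refine Finset.sum_congr rfl fun i _ => ?_
    rw [L.nabForm_ric, ← Finset.sum_neg_distrib]
    refine Finset.sum_congr rfl fun j _ => ?_
    rw [L.g_nabCurv, L.g_symm (L.dual j)]
  rw [Finset.sum_sub_distrib, Finset.sum_add_distrib, L.sum_nabForm_ric, hd] at hs
  rw [divSecond] at hs ⊢
  linear_combination hs

theorem nab_eq_sum (z v : X) : L.nab z v = ∑ i, L.g z (L.dual i) • L.nab (L.frame i) v := by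
  conv_lhs => rw [← L.sum_frame z]
  refine (map_sum (AddMonoidHom.mk' (fun u => L.nab u v) fun u u' => L.add_nab u u' v)
    _ _).trans ?_
  exact Finset.sum_congr rfl fun i _ => L.smul_nab _ _ _

/-- The Einstein tensor is divergence-free. -/
theorem divSecond_einstein (z : X) :
    L.divSecond (fun p q => 2 * L.ric p q - L.scal * L.g p q) z = 0 := by
  have h : ∀ y v w, L.nabForm (fun p q => 2 * L.ric p q - L.scal * L.g p q) y v w
      = 2 * L.nabForm (fun p q => L.ric p q) y v w - L.act y L.scal * L.g v w := fun y v w => by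
    simp only [nabForm, L.act_sub, L.act_mul, L.act_two, L.act_g]; ring
  simp only [divSecond, h, Finset.sum_sub_distrib, ← Finset.mul_sum]
  have h1 := L.act_scal z
  have h2 := L.act_eq_sum z L.scal
  simp only [mul_comm (L.g z _)] at h2
  rw [divSecond] at h1
  linear_combination h2 - h1

theorem div_smul (a : A) (v : X) : L.div (a • v) = L.act v a + a * L.div v := by
  rw [L.act_eq_sum v a, div, div, Finset.mul_sum, ← Finset.sum_add_distrib]
  refine Finset.sum_congr rfl fun i _ => ?_
  simp only [L.nab_smul, map_add, map_smul, LinearMap.add_apply, LinearMap.smul_apply, smul_eq_mul]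
  ring

theorem nabForm_tensor (a : A) (p q z v w : X) :
    L.nabForm (fun s t => a * (L.g p s * L.g q t)) z v w
      = L.act z a * (L.g p v * L.g q w) + a * (L.g (L.nab z p) v * L.g q w)
        + a * (L.g p v * L.g (L.nab z q) w) := by
  simp only [nabForm, L.act_mul, L.act_g]; ring

/-- The divergence of `a p ⊗ q`, contracted in the slot of `q`, is `div(aq) p + a ∇_q p`. -/
theorem divSecond_tensor (a : A) (p q z : X) :
    L.divSecond (fun s t => a * (L.g p s * L.g q t)) z
      = L.g p z * L.div (a • q) + a * L.g (L.nab q p) z := by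
  have h := congrArg (fun t => L.g t z) (L.nab_eq_sum q p)
  simp only [map_sum, LinearMap.sum_apply, map_smul, LinearMap.smul_apply, smul_eq_mul] at h
  rw [L.div_smul, L.act_eq_sum q a, h, div, divSecond]
  simp only [L.nabForm_tensor, Finset.sum_add_distrib, Finset.mul_sum, mul_add]
  have e1 : ∑ i, L.act (L.frame i) a * (L.g p z * L.g q (L.dual i))
      = ∑ i, L.g p z * (L.g q (L.dual i) * L.act (L.frame i) a) :=
    Finset.sum_congr rfl fun i _ => by ring
  have e2 : ∑ i, a * (L.g (L.nab (L.frame i) p) z * L.g q (L.dual i))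
      = ∑ i, a * (L.g q (L.dual i) * L.g (L.nab (L.frame i) p) z) :=
    Finset.sum_congr rfl fun i _ => by ring
  have e3 : ∑ i, a * (L.g p z * L.g (L.nab (L.frame i) q) (L.dual i))
      = ∑ i, L.g p z * (a * L.g (L.nab (L.frame i) q) (L.dual i)) :=
    Finset.sum_congr rfl fun i _ => by ring
  rw [e1, e2, e3]; ring

theorem dFlat_eq (y u v : X) : L.dFlat y u v = L.g (L.nab u y) v - L.g (L.nab v y) u := by
  simp only [dFlat, L.act_g, ← L.nab_sub_nab, map_sub]; ring

/-! ### Killing fields -/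

/-- The Lie derivative of the metric along `y` vanishes. -/
def IsKilling (y : X) : Prop :=
  ∀ u v, L.act y (L.g u v) = L.g (L.br y u) v + L.g u (L.br y v)

variable {L} {y : X} (hy : L.IsKilling y)
include hy

theorem IsKilling.g_nab_skew (u v : X) : L.g (L.nab u y) v = - L.g (L.nab v y) u := by
  have h := hy u v
  rw [L.act_g, ← L.nab_sub_nab, ← L.nab_sub_nab] at h
  simp only [map_sub, LinearMap.sub_apply] at h
  linear_combination h - L.g_symm u (L.nab v y)

theorem IsKilling.dFlat_eq (u v : X) : L.dFlat y u v = 2 * L.g (L.nab u y) v := by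
  rw [L.dFlat_eq, hy.g_nab_skew v u]; ring

theorem IsKilling.div_eq_zero : L.div y = 0 := by
  let B : X →ₗ[A] X →ₗ[A] A := LinearMap.mk₂ A (fun u v => L.g (L.nab u y) v)
    (fun _ _ _ => by simp [L.add_nab]) (fun _ _ _ => by simp [L.smul_nab])
    (fun _ _ _ => by simp) (fun _ _ _ => by simp)
  have h : L.div y = ∑ i, L.g (L.nab (L.dual i) y) (L.frame i) := L.sum_frame_dual_comm B
  simp only [hy.g_nab_skew (L.dual _), Finset.sum_neg_distrib] at h
  refine two_cancel ?_
  rw [div] at h ⊢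
  linear_combination h

/-- The flow of a Killing field preserves the Levi-Civita connection. The defect is symmetric in
its two arguments because the connection is torsion-free, and skew-adjoint because it is metric. -/
theorem IsKilling.br_nab (u v : X) :
    L.br y (L.nab u v) = L.nab (L.br y u) v + L.nab u (L.br y v) := by
  let D : X → X → X := fun u v => L.br y (L.nab u v) - L.nab (L.br y u) v - L.nab u (L.br y v)
  have hs : ∀ u v, D u v = D v u := fun u v => by
    have h := L.jacobi y u v
    rw [← L.nab_sub_nab u v, L.br_sub, ← L.nab_sub_nab (L.br y u), ← L.nab_sub_nab u (L.br y v)]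
      at h
    simp only [D]
    linear_combination (norm := abel) h
  have ha : ∀ u v w, L.g (D u v) w = - L.g (D u w) v := fun u v w => by
    have h := L.act_br y u (L.g v w)
    rw [hy v w, L.act_g u v w, L.act_add, L.act_add, hy, hy, L.act_g, L.act_g, L.act_g] at h
    simp only [D, map_sub, LinearMap.sub_apply]
    linear_combination -h - L.g_symm v (L.br y (L.nab u w)) + L.g_symm v (L.nab (L.br y u) w)
      + L.g_symm v (L.nab u (L.br y w))
  -- a trilinear form symmetric in one pair of slots and skew in another vanishes
  have h0 : D u v = 0 := L.eq_of_two_g fun w => by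
    have : L.g (D u v) w = - L.g (D u v) w := by
      conv_lhs => rw [ha, hs, ha, hs, ha, hs v u]
      ring
    rw [map_zero, LinearMap.zero_apply, mul_zero]
    linear_combination this
  simp only [D] at h0
  linear_combination (norm := abel) h0

theorem IsKilling.br_curv (u v w : X) :
    L.br y (L.curv u v w)
      = L.curv (L.br y u) v w + L.curv u (L.br y v) w + L.curv u v (L.br y w) := by
  simp only [curv, L.br_sub, hy.br_nab, L.nab_add, L.jacobi y u v, L.add_nab]
  abel

theorem IsKilling.act_ric (v w : X) :
    L.act y (L.ric v w) = L.ric (L.br y v) w + L.ric v (L.br y w) := by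
  have h := L.sum_derivation_eq_zero (L.act_zero y) (L.act_one y) hy (L.curvForm v w)
  simp only [curvForm, LinearMap.mk₂_apply, Finset.sum_add_distrib] at h
  simp only [ric_apply, L.act_sum, hy _ _, hy.br_curv, map_add, LinearMap.add_apply,
    Finset.sum_add_distrib]
  linear_combination h

theorem IsKilling.act_scal : L.act y L.scal = 0 := by
  have h := L.sum_derivation_eq_zero (L.act_zero y) (L.act_one y) hy L.ric
  simp only [scal, L.act_sum, hy.act_ric]
  exact h

/-- The second covariant derivative of a Killing field is given by the curvature. -/
theorem IsKilling.curv_eq (u v : X) :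
    L.curv y u v = L.nab (L.nab u v) y - L.nab u (L.nab v y) := by
  have h := hy.br_nab u v
  rw [← L.nab_sub_nab y v, ← L.nab_sub_nab y (L.nab u v), L.nab_sub] at h
  rw [curv]
  linear_combination (norm := abel) h

/-- The divergence of the exterior derivative of a Killing 1-form is a multiple of its Ricci
curvature. -/
theorem IsKilling.sum_nabForm_dFlat (w : X) :
    ∑ i, L.nabForm (L.dFlat y) (L.frame i) (L.dual i) w = -2 * L.ric y w := by
  rw [ric_apply, Finset.mul_sum]
  refine Finset.sum_congr rfl fun i _ => ?_
  have h := congrArg (fun t => L.g t w) (hy.curv_eq (L.frame i) (L.dual i))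
  have h2 := L.g_curv y (L.frame i) (L.dual i) w
  rw [L.curv_skew y (L.frame i) w, map_neg, L.g_symm (L.dual i)] at h2
  simp only [map_sub, LinearMap.sub_apply] at h
  simp only [nabForm, hy.dFlat_eq, L.act_mul, L.act_two, L.act_g]
  linear_combination 2 * h - 2 * h2

end MetricLieRinehart

/-! ### Charged dust in a Lie–Rinehart algebra -/

namespace MetricLieRinehart

variable {A X ι : Type*} [CommRing A] [AddCommGroup X] [Module A X] [Fintype ι] [DecidableEq ι]

/-- The Einstein tensor of charged dust with density `μ`, velocity `x`, charge density `e`,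
potential `y` and coefficient `γ`. -/
def dustTensor (L : MetricLieRinehart A X ι) (y x : X) (μ e γ : A) (u v : X) : A :=
  μ * (L.g x u * L.g x v) + e * (L.g x u * L.g y v + L.g y u * L.g x v) + γ * (L.g y u * L.g y v)

variable [Invertible (2 : A)]

/-- Charged dust with velocity `x` in the presence of the unit Killing potential `y`. The Einstein
equation is multiplied by `2`. -/
structure IsDust (L : MetricLieRinehart A X ι) (y x : X) (μ e γ : A) : Prop where
  killing : L.IsKilling y
  unit_y : L.g y y = -1
  unit_x : L.g x x = -1
  orth : L.g x y = 0
  isUnit : IsUnit μ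
  einstein : ∀ u v, 2 * L.ric u v - L.scal * L.g u v = 2 * L.dustTensor y x μ e γ u v

namespace IsDust

variable {L : MetricLieRinehart A X ι} {y x : X} {μ e γ : A} (h : L.IsDust y x μ e γ)
include h

theorem orth' : L.g y x = 0 := by rw [L.g_symm, h.orth]

theorem g_nab_y (u : X) : L.g (L.nab u y) y = 0 := by
  have h1 := L.act_g u y y
  rw [h.unit_y, L.act_neg, L.act_one, L.g_symm y] at h1
  exact two_cancel (by linear_combination -h1)

theorem g_nab_x (u : X) : L.g (L.nab u x) x = 0 := by
  have h1 := L.act_g u x x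
  rw [h.unit_x, L.act_neg, L.act_one, L.g_symm x] at h1
  exact two_cancel (by linear_combination -h1)

theorem nab_y_y : L.nab y y = 0 := L.eq_of_g fun w => by
  rw [h.killing.g_nab_skew, h.g_nab_y]; simp

theorem g_nab_x_y : L.g (L.nab x x) y = 0 := by
  have h1 := L.act_g x x y
  have h2 := h.killing.g_nab_skew x x
  rw [h.orth, L.act_zero, L.g_symm x] at h1
  refine two_cancel ?_
  linear_combination -2 * h1 - h2

/-- The Lie derivative of the dust tensor along the potential vanishes, since it is the Einstein
tensor. -/
theorem act_dustTensor (u v : X) : L.act y (L.dustTensor y x μ e γ u v)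
    = L.dustTensor y x μ e γ (L.br y u) v + L.dustTensor y x μ e γ u (L.br y v) := by
  refine two_cancel ?_
  have h1 := congrArg (L.act y) (h.einstein u v)
  simp only [L.act_sub, L.act_mul, L.act_two, h.killing.act_ric, h.killing.act_scal] at h1
  rw [h.killing u v] at h1
  linear_combination -h1 + h.einstein (L.br y u) v + h.einstein u (L.br y v)

theorem g_br_x : L.g x (L.br y x) = 0 := by
  have h1 := h.killing x x
  rw [h.unit_x, L.act_neg, L.act_one, L.g_symm (L.br y x)] at h1
  exact two_cancel (by linear_combination -h1)

theorem g_br_y : L.g y (L.br y x) = 0 := by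
  have h1 := h.killing y x
  rw [h.orth', L.act_zero, L.br_self] at h1
  simpa using h1.symm

theorem act_y_e : L.act y e = 0 := by
  have h1 := h.act_dustTensor y x
  simp only [dustTensor, L.br_self, h.g_br_x, h.g_br_y, h.orth, h.orth', h.unit_x, h.unit_y,
    L.act_neg, L.act_mul, L.act_add, L.act_zero, L.act_one, map_zero] at h1
  linear_combination h1

theorem act_y_μ : L.act y μ = 0 := by
  have h1 := h.act_dustTensor x x
  simp only [dustTensor, h.g_br_x, h.g_br_y, h.orth', h.unit_x,
    L.act_neg, L.act_mul, L.act_add, L.act_zero, L.act_one] at h1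
  linear_combination h1

/-- The flow of the potential preserves the velocity: the velocity is characterized in terms of the
potential and of the Einstein tensor, both of which the flow preserves. -/
theorem br_y_x : L.br y x = 0 := by
  refine L.eq_of_g fun v => ?_
  have h1 := h.act_dustTensor x v
  simp only [dustTensor, h.g_br_x, h.g_br_y, h.orth', h.unit_x, L.act_neg, L.act_mul,
    L.act_add, L.act_zero, L.act_one, h.act_y_μ, h.act_y_e, h.killing x v, h.killing y v, L.br_self,
    map_zero, LinearMap.zero_apply] at h1
  rw [map_zero, LinearMap.zero_apply]
  refine h.isUnit.mul_left_cancel ?_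
  linear_combination -h1

theorem nab_y_x : L.nab y x = L.nab x y := by
  rw [← sub_eq_zero, L.nab_sub_nab, h.br_y_x]

/-- The Einstein tensor is divergence-free, written out for the dust tensor. The divergence of the
potential, its acceleration and its bracket with the velocity have dropped out. -/
theorem divSecond_dustTensor (z : X) :
    L.g x z * L.div (μ • x) + μ * L.g (L.nab x x) z + L.g y z * L.div (e • x)
      + 2 * (e * L.g (L.nab x y) z) + L.g y z * L.act y γ = 0 := by
  have h1 := L.divSecond_einstein z
  have h2 : (fun p q => 2 * L.ric p q - L.scal * L.g p q)
      = fun p q => 2 * L.dustTensor y x μ e γ p q := by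
    ext p q; exact h.einstein p q
  have h3 : L.divSecond (fun p q => 2 * L.dustTensor y x μ e γ p q) z
      = 2 * (L.divSecond (fun s t => μ * (L.g x s * L.g x t)) z
        + L.divSecond (fun s t => e * (L.g x s * L.g y t)) z
        + L.divSecond (fun s t => e * (L.g y s * L.g x t)) z
        + L.divSecond (fun s t => γ * (L.g y s * L.g y t)) z) := by
    simp only [divSecond, ← Finset.sum_add_distrib, Finset.mul_sum]
    refine Finset.sum_congr rfl fun i _ => ?_
    simp only [nabForm, dustTensor, L.act_mul, L.act_add, L.act_two]
    ring
  rw [h2, h3] at h1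
  simp only [L.divSecond_tensor, L.div_smul _ y, h.killing.div_eq_zero, h.nab_y_y, h.nab_y_x,
    h.act_y_e, map_zero, LinearMap.zero_apply, mul_zero, add_zero] at h1
  refine two_cancel ?_
  linear_combination h1

theorem act_y_γ : L.act y γ = 0 := by
  have h1 := h.act_dustTensor y y
  simp only [dustTensor, L.br_self, h.orth, h.unit_y,
    L.act_neg, L.act_mul, L.act_add, L.act_zero, L.act_one, map_zero] at h1
  linear_combination h1

/-- Conservation of mass: the component of `div G = 0` along the velocity. -/
theorem div_μ : L.div (μ • x) = 0 := by
  have h1 := h.divSecond_dustTensor x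
  have h2 := h.killing.g_nab_skew x x
  rw [h.unit_x, h.orth', h.g_nab_x] at h1
  linear_combination -h1 + e * h2

/-- Conservation of charge: the component of `div G = 0` along the potential. -/
theorem div_e : L.div (e • x) = 0 := by
  have h1 := h.divSecond_dustTensor y
  rw [h.unit_y, h.orth, h.g_nab_x_y, h.g_nab_y, h.act_y_γ] at h1
  linear_combination -h1

/-- The Lorentz equation, where `-2 ∇_x y` is the Lorentz force per unit charge. -/
theorem lorentz : μ • L.nab x x + (2 * e) • L.nab x y = 0 := L.eq_of_g fun z => by
  have h1 := h.divSecond_dustTensor z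
  rw [h.div_μ, h.div_e, h.act_y_γ] at h1
  simp only [map_add, map_smul, LinearMap.add_apply, LinearMap.smul_apply, smul_eq_mul, map_zero,
    LinearMap.zero_apply]
  linear_combination h1

/-- The specific charge `q = e / μ` is constant along the flow lines: this compares the two
conservation laws. -/
theorem act_quotient {q : A} (hq : q * μ = e) : L.act x q = 0 := by
  have h1 := h.div_e
  rw [← hq, mul_smul, L.div_smul, h.div_μ, L.act_smul_left, mul_zero, add_zero] at h1
  refine h.isUnit.mul_left_cancel ?_
  rw [h1, mul_zero]

theorem act_y_quotient {q : A} (hq : q * μ = e) : L.act y q = 0 := by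
  have h1 := congrArg (L.act y) hq
  rw [h.act_y_e, L.act_mul, h.act_y_μ, mul_zero, add_zero] at h1
  refine h.isUnit.mul_left_cancel ?_
  rw [mul_comm, h1, mul_zero]

theorem nab_total {q : A} (hq : q * μ = e) :
    L.nab (x + q • y) (x + q • y) = L.nab x x + (2 * q) • L.nab x y := by
  rw [L.add_nab, L.smul_nab, L.nab_add, L.nab_add, L.nab_smul, L.nab_smul, h.nab_y_y, h.nab_y_x,
    h.act_quotient hq, h.act_y_quotient hq]
  module

theorem smul_nab_total {q : A} (hq : q * μ = e) :
    μ • L.nab (x + q • y) (x + q • y) = μ • L.nab x x + (2 * e) • L.nab x y := by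
  rw [h.nab_total hq, ← hq]; module

theorem geodesic {q : A} (hq : q * μ = e) : L.nab (x + q • y) (x + q • y) = 0 := by
  have h1 := h.smul_nab_total hq
  rw [h.lorentz] at h1
  exact h.isUnit.smul_left_cancel.mp (by rw [h1, smul_zero])

/-- The inhomogeneous Maxwell equation. -/
theorem maxwell (w : X) : ∑ i, L.nabForm (L.dFlat y) (L.frame i) (L.dual i) w
    = L.g ((2 * e) • x + (2 * γ - L.scal) • y) w := by
  have h1 := h.einstein y w
  rw [dustTensor, h.unit_y, h.orth] at h1
  simp only [map_add, map_smul, LinearMap.add_apply, LinearMap.smul_apply, smul_eq_mul]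
  rw [h.killing.sum_nabForm_dFlat]
  linear_combination -h1

end IsDust

end MetricLieRinehart

/-! ### Vector fields on a manifold -/

section Fields

variable {n : ℕ} {M : Type*} [TopologicalSpace M] [ChartedSpace (EuclideanSpace ℝ (Fin n)) M]
  {x : M} {U V W : ∀ x : M, Tan n x}

/-- The function `f` is differentiable at `x`. -/
abbrev DiffFunAt (n : ℕ) {M : Type*} [TopologicalSpace M]
    [ChartedSpace (EuclideanSpace ℝ (Fin n)) M] (f : M → ℝ) (x : M) : Prop :=
  MDifferentiableAt (𝓡 n) 𝓘(ℝ, ℝ) f x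

/-- The function `f` is smooth at `x`. -/
abbrev SmoothFunAt (n : ℕ) {M : Type*} [TopologicalSpace M]
    [ChartedSpace (EuclideanSpace ℝ (Fin n)) M] (f : M → ℝ) (x : M) : Prop :=
  ContMDiffAt (𝓡 n) 𝓘(ℝ, ℝ) ∞ f x

theorem dirDeriv_mul {f h : M → ℝ} (hf : DiffFunAt n f x) (hh : DiffFunAt n h x) :
    dirDeriv V (fun y => f y * h y) x = dirDeriv V f x * h x + f x * dirDeriv V h x := by
  simp only [dirDeriv]
  rw [mvfderiv_fun_mul hf hh]
  simp; ring

theorem dirDeriv_add {f h : M → ℝ} (hf : DiffFunAt n f x) (hh : DiffFunAt n h x) :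
    dirDeriv V (fun y => f y + h y) x = dirDeriv V f x + dirDeriv V h x := by
  simp only [dirDeriv]
  rw [mvfderiv_fun_add hf hh]
  simp

theorem add_dirDeriv (f : M → ℝ) : dirDeriv (U + V) f x = dirDeriv U f x + dirDeriv V f x := by
  simp [dirDeriv]

theorem smul_dirDeriv (h f : M → ℝ) : dirDeriv (h • V) f x = h x * dirDeriv V f x := by
  simp [dirDeriv]

theorem dirDeriv_congr {f h : M → ℝ} (hU : U x = V x) (hf : f =ᶠ[𝓝 x] h) :
    dirDeriv U f x = dirDeriv V h x := by
  simp only [dirDeriv, hU, mvfderiv]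
  rw [hf.mfderiv_eq]
  congr!

variable [IsManifold (𝓡 n) ∞ M]

instance isManifold_minSmoothness_two : IsManifold (𝓡 n) (minSmoothness ℝ 2) M := by
  rw [minSmoothness_of_isRCLikeNormedField]; infer_instance

instance isManifold_minSmoothness_three : IsManifold (𝓡 n) (minSmoothness ℝ 3) M := by
  rw [minSmoothness_of_isRCLikeNormedField]; infer_instance

theorem two_le_infty : (2 : WithTop ℕ∞) ≤ ∞ := WithTop.coe_le_coe.2 (le_top : (2 : ℕ∞) ≤ ⊤)

/-- The vector field `V` is differentiable at `x`. -/
def DiffFieldAt (V : ∀ x : M, Tan n x) (x : M) : Prop :=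
  MDifferentiableAt (𝓡 n) (𝓡 n).tangent (fun y => (⟨y, V y⟩ : TangentBundle (𝓡 n) M)) x

theorem SmoothFunAt.eventually_diff {f : M → ℝ} (hf : SmoothFunAt n f x) :
    ∀ᶠ y in 𝓝 x, DiffFunAt n f y := by
  have h1 : ContMDiffAt (𝓡 n) 𝓘(ℝ, ℝ) 1 f x := ContMDiffAt.of_le hf (by simp)
  rw [contMDiffAt_iff_contMDiffAt_nhds (by simp)] at h1
  exact h1.mono fun y hy => hy.mdifferentiableAt (by simp)

theorem SmoothFieldAt.eventually_two (hV : SmoothFieldAt V x) :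
    ∀ᶠ y in 𝓝 x, ContMDiffAt (𝓡 n) (𝓡 n).tangent 2
      (fun z => (⟨z, V z⟩ : TangentBundle (𝓡 n) M)) y := by
  have h1 : ContMDiffAt (𝓡 n) (𝓡 n).tangent 2
      (fun z => (⟨z, V z⟩ : TangentBundle (𝓡 n) M)) x :=
    ContMDiffAt.of_le hV two_le_infty
  rwa [contMDiffAt_iff_contMDiffAt_nhds (by simp)] at h1

theorem SmoothFieldAt.eventually_diff (hV : SmoothFieldAt V x) :
    ∀ᶠ y in 𝓝 x, DiffFieldAt V y :=
  hV.eventually_two.mono fun y hy => hy.mdifferentiableAt (by simp)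

theorem SmoothFieldAt.diff (hV : SmoothFieldAt V x) : DiffFieldAt V x :=
  hV.eventually_diff.self_of_nhds

theorem SmoothFieldAt.smul {f : M → ℝ} (hf : SmoothFunAt n f x) (hV : SmoothFieldAt V x) :
    SmoothFieldAt (f • V) x :=
  ContMDiffAt.smul_section hf hV

theorem SmoothFieldAt.mlieBracket (hU : SmoothFieldAt U x) (hV : SmoothFieldAt V x) :
    SmoothFieldAt (mlieBracket (𝓡 n) U V) x := by
  have : IsManifold (𝓡 n) (((⊤ : ℕ∞) : WithTop ℕ∞) + 1) M :=
    inferInstanceAs (IsManifold (𝓡 n) ∞ M)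
  refine ContMDiffAt.mlieBracket_vectorField (m := ⊤) (n := ⊤) hU hV ?_
  rw [minSmoothness_of_isRCLikeNormedField]; exact le_rfl

/-- An extension of the tangent vector `v` at `x` to a vector field that is smooth at `x`. -/
def extendTan (x : M) (v : Tan n x) : ∀ y : M, Tan n y :=
  FiberBundle.extend (EuclideanSpace ℝ (Fin n)) v

@[simp] theorem extendTan_self (x : M) (v : Tan n x) : extendTan x v x = v :=
  FiberBundle.extend_apply_self _ v

theorem smooth_extendTan (x : M) (v : Tan n x) : SmoothFieldAt (extendTan x v) x :=
  FiberBundle.contMDiffAt_extend (𝓡 n) (EuclideanSpace ℝ (Fin n)) v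

theorem mlieBracket_smul {f : M → ℝ} (hf : DiffFunAt n f x) (hV : DiffFieldAt V x) :
    mlieBracket (𝓡 n) U (f • V) x
      = dirDeriv U f x • V x + f x • mlieBracket (𝓡 n) U V x :=
  mlieBracket_smul_right hf hV

theorem smul_mlieBracket {f : M → ℝ} (hf : DiffFunAt n f x) (hU : DiffFieldAt U x) :
    mlieBracket (𝓡 n) (f • U) V x
      = f x • mlieBracket (𝓡 n) U V x - dirDeriv V f x • U x := by
  rw [mlieBracket_smul_left hf hU, neg_smul, sub_eq_add_neg, add_comm]; rfl

/-- The proof reads the derivative of `f` and the vector field in the trivialization of the tangent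
bundle at `x`. -/
theorem smoothFunAt_dirDeriv {f : M → ℝ} (hV : SmoothFieldAt V x) (hf : SmoothFunAt n f x) :
    SmoothFunAt n (dirDeriv V f) x := by
  have h1 := ContMDiffAt.mfderiv (J := 𝓡 n) (I := 𝓡 n) (I' := 𝓘(ℝ, ℝ)) (m := ∞) (n := ∞)
    (x₀ := x) (fun _ : M => f) id (by
      exact ContMDiffAt.comp (x, x) (g := f) hf contMDiffAt_snd) contMDiffAt_id (by simp)
  have h2 := (contMDiffAt_section (s := V) x).1 hV
  have h3 := ContMDiffAt.clm_apply h1 h2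
  refine h3.congr_of_eventuallyEq ?_
  filter_upwards [(trivializationAt (EuclideanSpace ℝ (Fin n)) (TangentSpace (𝓡 n)) x).open_baseSet
    |>.mem_nhds (FiberBundle.mem_baseSet_trivializationAt' x)] with y hy
  have e1 : (trivializationAt (EuclideanSpace ℝ (Fin n)) (TangentSpace (𝓡 n)) x).symmL ℝ y
      (trivializationAt (EuclideanSpace ℝ (Fin n)) (TangentSpace (𝓡 n)) x ⟨y, V y⟩).2 = V y := by
    have := (trivializationAt (EuclideanSpace ℝ (Fin n)) (TangentSpace (𝓡 n)) x
      ).symmL_continuousLinearMapAt (R := ℝ) hy (V y)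
    rwa [Trivialization.continuousLinearMapAt_apply_of_mem _ _ hy] at this
  simp only [inTangentCoordinates, ContinuousLinearMap.inCoordinates, dirDeriv, mvfderiv,
    ContinuousLinearMap.comp_apply, id]
  rw [e1, TangentBundle.continuousLinearMapAt_model_space]
  rfl

end Fields

namespace SemiRiemannianMetric

variable {n : ℕ} {M : Type*} [TopologicalSpace M] [ChartedSpace (EuclideanSpace ℝ (Fin n)) M]
  [IsManifold (𝓡 n) ∞ M] (g : SemiRiemannianMetric n M) {x : M} {U V W : ∀ x : M, Tan n x}

/-! ### The Levi-Civita connection on a manifold -/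

theorem smooth_innerFields (hU : SmoothFieldAt U x) (hV : SmoothFieldAt V x) :
    SmoothFunAt n (g.innerFields U V) x := by
  have h : ContMDiffAt (𝓡 n) ((𝓡 n).prod 𝓘(ℝ)) ∞
      (fun y => TotalSpace.mk' ℝ (E := Bundle.Trivial M ℝ) y (g.inner y (U y) (V y))) x :=
    ContMDiffAt.clm_bundle_apply₂ (F₁ := EuclideanSpace ℝ (Fin n))
      (F₂ := EuclideanSpace ℝ (Fin n)) g.contMDiff.contMDiffAt hU hV
  simp only [contMDiffAt_totalSpace] at h
  exact h.2

theorem diff_innerFields (hU : DiffFieldAt U x) (hV : DiffFieldAt V x) :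
    DiffFunAt n (g.innerFields U V) x := by
  have h : MDifferentiableAt (𝓡 n) ((𝓡 n).prod 𝓘(ℝ))
      (fun y => TotalSpace.mk' ℝ (E := Bundle.Trivial M ℝ) y (g.inner y (U y) (V y))) x :=
    MDifferentiableAt.clm_bundle_apply₂ (F₁ := EuclideanSpace ℝ (Fin n))
      (F₂ := EuclideanSpace ℝ (Fin n)) (g.contMDiff.mdifferentiableAt (by simp)) hU hV
  simp only [mdifferentiableAt_totalSpace] at h
  exact h.2

theorem innerFields_comm (U V : ∀ x : M, Tan n x) : g.innerFields U V = g.innerFields V U :=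
  funext fun _ => g.symm _ _ _

theorem add_innerFields (U V W : ∀ x : M, Tan n x) :
    g.innerFields (U + V) W = fun y => g.innerFields U W y + g.innerFields V W y := by
  funext y; simp [innerFields]

theorem smul_innerFields (f : M → ℝ) (U V : ∀ x : M, Tan n x) :
    g.innerFields (f • U) V = fun y => f y * g.innerFields U V y := by
  funext y; simp [innerFields]

theorem innerFields_add (U V W : ∀ x : M, Tan n x) :
    g.innerFields W (U + V) = fun y => g.innerFields W U y + g.innerFields W V y := by
  funext y; simp [innerFields]

theorem innerFields_smul (f : M → ℝ) (U V : ∀ x : M, Tan n x) :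
    g.innerFields V (f • U) = fun y => f y * g.innerFields V U y := by
  funext y; simp [innerFields]

/-- The Koszul expression depends only on the value of its first argument at the point, so that it
defines a linear map and `nabla` is not a junk value. -/
theorem tensorialAt_koszul_left (hV : DiffFieldAt V x) (hW : DiffFieldAt W x) :
    TensorialAt (𝓡 n) (EuclideanSpace ℝ (Fin n)) (fun U => g.koszul U V W x) x where
  smul {f U} hf hU := by
    have hU : DiffFieldAt U x := hU
    have h1 := g.diff_innerFields hW hU
    have h2 := g.diff_innerFields hU hV
    simp only [koszul, g.innerFields_smul, g.smul_innerFields, dirDeriv_mul hf h1,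
      dirDeriv_mul hf h2, smul_mlieBracket hf hU, smul_dirDeriv]
    simp only [innerFields, map_sub, map_smul, sub_apply, smul_apply,
      Pi.smul_apply', smul_eq_mul, g.symm x (W x) (U x)]
    ring
  add {U U'} hU hU' := by
    have hU : DiffFieldAt U x := hU
    have hU' : DiffFieldAt U' x := hU'
    simp only [koszul, g.innerFields_add, g.add_innerFields,
      dirDeriv_add (g.diff_innerFields hW hU) (g.diff_innerFields hW hU'),
      dirDeriv_add (g.diff_innerFields hU hV) (g.diff_innerFields hU' hV),
      mlieBracket_add_left (I := 𝓡 n) (W := V) hU hU',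
      mlieBracket_add_left (I := 𝓡 n) (W := W) hU hU', add_dirDeriv]
    simp only [map_add, add_apply, Pi.add_apply]
    ring

theorem tensorialAt_koszul_right (hU : DiffFieldAt U x) (hV : DiffFieldAt V x) :
    TensorialAt (𝓡 n) (EuclideanSpace ℝ (Fin n)) (fun W => g.koszul U V W x) x where
  smul {f W} hf hW := by
    have hW : DiffFieldAt W x := hW
    simp only [koszul, g.innerFields_smul, g.smul_innerFields,
      dirDeriv_mul hf (g.diff_innerFields hV hW), dirDeriv_mul hf (g.diff_innerFields hW hU),
      mlieBracket_smul hf hW, smul_dirDeriv]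
    simp only [innerFields, map_add, map_smul, add_apply, smul_apply,
      Pi.smul_apply', smul_eq_mul, g.symm x (V x) (W x)]
    ring
  add {W W'} hW hW' := by
    have hW : DiffFieldAt W x := hW
    have hW' : DiffFieldAt W' x := hW'
    simp only [koszul, g.innerFields_add, g.add_innerFields,
      dirDeriv_add (g.diff_innerFields hV hW) (g.diff_innerFields hV hW'),
      dirDeriv_add (g.diff_innerFields hW hU) (g.diff_innerFields hW' hU),
      mlieBracket_add_right (I := 𝓡 n) (V := V) hW hW',
      mlieBracket_add_right (I := 𝓡 n) (V := U) hW hW', add_dirDeriv]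
    simp only [map_add, add_apply, Pi.add_apply]
    ring

/-- The Koszul formula characterizes `∇V` at every point where `V` is differentiable. -/
theorem inner_nabla (hU : DiffFieldAt U x) (hV : DiffFieldAt V x) (hW : DiffFieldAt W x) :
    g.inner x (g.nabla V x (U x)) (W x) = g.koszul U V W x := by
  let K := TensorialAt.mkHom₂ (I := 𝓡 n) (F := EuclideanSpace ℝ (Fin n))
    (F' := EuclideanSpace ℝ (Fin n)) (fun U W => g.koszul U V W x) x
    (fun W hW => g.tensorialAt_koszul_left hV hW) (fun U hU => g.tensorialAt_koszul_right hU hV)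
  have hK : ∀ {U W : ∀ x : M, Tan n x}, DiffFieldAt U x → DiffFieldAt W x →
      K (U x) (W x) = g.koszul U V W x := fun hU hW => TensorialAt.mkHom₂_apply _ _ hU hW
  let A : Tan n x →ₗ[ℝ] Tan n x :=
    ((g.form x).toDual (g.form_nondegenerate x)).symm.toLinearMap ∘ₗ
      (LinearMap.mk₂ ℝ (fun u w => K u w) (by simp) (by simp) (by simp) (by simp))
  have hA : ∀ u w, g.inner x (A u) w = K u w := fun u w => g.inner_sharp x _ w
  have hspec : ∀ U W : ∀ y : M, Tan n y, SmoothFieldAt U x → SmoothFieldAt W x →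
      g.inner x (g.nabla V x (U x)) (W x) = g.koszul U V W x :=
    Classical.epsilon_spec (p := fun A : Tan n x →ₗ[ℝ] Tan n x =>
      ∀ U W : ∀ y : M, Tan n y, SmoothFieldAt U x → SmoothFieldAt W x →
        g.inner x (A (U x)) (W x) = g.koszul U V W x)
      ⟨A, fun U W hU hW => by rw [hA, hK hU.diff hW.diff]⟩
  rw [← hK hU hW]
  have h := hspec _ _ (smooth_extendTan x (U x)) (smooth_extendTan x (W x))
  rw [← hK (smooth_extendTan x (U x)).diff (smooth_extendTan x (W x)).diff] at h
  simpa using h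

end SemiRiemannianMetric

/-! ### Germs of functions and vector fields -/

section Germs

variable {n : ℕ} {M : Type*} [TopologicalSpace M] [ChartedSpace (EuclideanSpace ℝ (Fin n)) M]

/-- The ring of germs at `x` of functions that are smooth at `x`. -/
def smoothGerms (n : ℕ) {M : Type*} [TopologicalSpace M]
    [ChartedSpace (EuclideanSpace ℝ (Fin n)) M] (x : M) : Subring (Filter.Germ (𝓝 x) ℝ) where
  carrier := {a | ∃ f : M → ℝ, SmoothFunAt n f x ∧ (f : Filter.Germ (𝓝 x) ℝ) = a}
  mul_mem' := by
    rintro _ _ ⟨f, hf, rfl⟩ ⟨h, hh, rfl⟩; exact ⟨f * h, ContMDiffAt.mul hf hh, rfl⟩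
  one_mem' := ⟨1, contMDiffAt_const, rfl⟩
  add_mem' := by
    rintro _ _ ⟨f, hf, rfl⟩ ⟨h, hh, rfl⟩; exact ⟨f + h, ContMDiffAt.add hf hh, rfl⟩
  zero_mem' := ⟨0, contMDiffAt_const, rfl⟩
  neg_mem' := by
    rintro _ ⟨f, hf, rfl⟩; exact ⟨-f, ContMDiffAt.neg hf, rfl⟩

/-- The type of germs at `x` of smooth functions. -/
abbrev FunGerm (n : ℕ) {M : Type*} [TopologicalSpace M]
    [ChartedSpace (EuclideanSpace ℝ (Fin n)) M] (x : M) : Type _ := smoothGerms n x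

/-- The germs at `x` of smooth vector fields, given by their coefficients in the frame of the
tangent bundle that comes from the preferred chart at `x`. -/
abbrev FieldGerm (n : ℕ) {M : Type*} [TopologicalSpace M]
    [ChartedSpace (EuclideanSpace ℝ (Fin n)) M] (x : M) : Type _ := Fin n → FunGerm n x

variable {x : M}

/-- The function `f` has germ `a` at `x`. -/
def HasGerm (f : M → ℝ) (a : FunGerm n x) : Prop := (f : Filter.Germ (𝓝 x) ℝ) = a

/-- A representative of a germ of functions. -/
def FunGerm.rep (a : FunGerm n x) : M → ℝ := a.2.choose

theorem FunGerm.smooth_rep (a : FunGerm n x) : SmoothFunAt n a.rep x := a.2.choose_spec.1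

theorem FunGerm.hasGerm_rep (a : FunGerm n x) : HasGerm a.rep a := a.2.choose_spec.2

/-- The value at `x` of a germ of functions at `x`. -/
def FunGerm.value : FunGerm n x →+* ℝ := Filter.Germ.valueRingHom.comp (smoothGerms n x).subtype

theorem SmoothFunAt.exists_germ {f : M → ℝ} (hf : SmoothFunAt n f x) :
    ∃ a : FunGerm n x, HasGerm f a := ⟨⟨f, f, hf, rfl⟩, rfl⟩

namespace HasGerm

variable {f h : M → ℝ} {a c : FunGerm n x}

theorem eventuallyEq (hf : HasGerm f a) (hh : HasGerm h a) : f =ᶠ[𝓝 x] h :=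
  Filter.Germ.coe_eq.1 (hf.trans hh.symm)

theorem congr (hf : HasGerm f a) (hfh : h =ᶠ[𝓝 x] f) : HasGerm h a :=
  (Filter.Germ.coe_eq.2 hfh).trans hf

theorem unique (hf : HasGerm f a) (hf' : HasGerm h c) (hfh : f =ᶠ[𝓝 x] h) : a = c :=
  Subtype.ext ((hf.congr hfh.symm).symm.trans hf')

theorem smooth (hf : HasGerm f a) : SmoothFunAt n f x :=
  a.smooth_rep.congr_of_eventuallyEq (hf.eventuallyEq a.hasGerm_rep)

theorem value (hf : HasGerm f a) : a.value = f x := congrArg Filter.Germ.value hf.symm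

theorem add (hf : HasGerm f a) (hh : HasGerm h c) : HasGerm (fun y => f y + h y) (a + c) :=
  congrArg₂ (· + ·) hf hh

theorem sub (hf : HasGerm f a) (hh : HasGerm h c) : HasGerm (fun y => f y - h y) (a - c) :=
  congrArg₂ (· - ·) hf hh

theorem mul (hf : HasGerm f a) (hh : HasGerm h c) : HasGerm (fun y => f y * h y) (a * c) :=
  congrArg₂ (· * ·) hf hh

theorem neg (hf : HasGerm f a) : HasGerm (fun y => - f y) (-a) := congrArg (- ·) hf

theorem zero : HasGerm (fun _ => 0) (0 : FunGerm n x) := rfl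

theorem one : HasGerm (fun _ => 1) (1 : FunGerm n x) := rfl

theorem two : HasGerm (fun _ => 2) (2 : FunGerm n x) := by
  simpa only [one_add_one_eq_two] using (one (n := n) (x := x)).add one

theorem sum {κ : Type*} {s : Finset κ} {f : κ → M → ℝ} {a : κ → FunGerm n x}
    (hf : ∀ i ∈ s, HasGerm (f i) (a i)) : HasGerm (fun y => ∑ i ∈ s, f i y) (∑ i ∈ s, a i) := by
  classical
  induction s using Finset.induction_on with
  | empty => simpa using zero
  | insert i s hi ih =>
    simp only [Finset.sum_insert hi]
    exact (hf i (by simp)).add (ih fun j hj => hf j (by simp [hj]))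

end HasGerm

/-- Germs of functions that do not vanish at the base point are invertible. -/
theorem FunGerm.isUnit {a : FunGerm n x} (ha : a.value ≠ 0) : IsUnit a := by
  have h0 : a.rep x ≠ 0 := by rwa [a.hasGerm_rep.value] at ha
  obtain ⟨c, hc⟩ := SmoothFunAt.exists_germ (n := n) (f := fun y => (a.rep y)⁻¹) (x := x)
    (ContMDiffAt.inv₀ a.smooth_rep h0)
  refine IsUnit.of_mul_eq_one c ((a.hasGerm_rep.mul hc).unique HasGerm.one ?_)
  filter_upwards [a.smooth_rep.continuousAt.eventually_ne h0] with y hy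
  exact mul_inv_cancel₀ hy

instance : Invertible (2 : FunGerm n x) :=
  (FunGerm.isUnit (a := (2 : FunGerm n x)) (by rw [map_ofNat]; norm_num)).invertible

/-- The value at `x` of a germ of functions at `x`, as a semilinear map. -/
def funValue (x : M) : FunGerm n x →ₛₗ[(FunGerm.value : FunGerm n x →+* ℝ)] ℝ where
  toFun := FunGerm.value
  map_add' := map_add _
  map_smul' := map_mul _

theorem HasGerm.funValue {f : M → ℝ} {a : FunGerm n x} (hf : HasGerm f a) :
    funValue x a = f x := hf.value

variable [IsManifold (𝓡 n) ∞ M]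

/-- The frame of the tangent bundle near `x` that comes from the preferred chart at `x`. -/
def chartFrame (x : M) (i : Fin n) : ∀ y : M, Tan n y :=
  (trivializationAt (EuclideanSpace ℝ (Fin n)) (TangentSpace (𝓡 n)) x).localFrame
    (EuclideanSpace.basisFun (Fin n) ℝ).toBasis i

/-- The domain of `chartFrame x`. -/
def frameDomain (n : ℕ) {M : Type*} [TopologicalSpace M]
    [ChartedSpace (EuclideanSpace ℝ (Fin n)) M] [IsManifold (𝓡 n) ∞ M] (x : M) : Set M :=
  (trivializationAt (EuclideanSpace ℝ (Fin n)) (TangentSpace (𝓡 n) : M → Type _) x).baseSet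

theorem eventually_mem_frameDomain (n : ℕ) {M : Type*} [TopologicalSpace M]
    [ChartedSpace (EuclideanSpace ℝ (Fin n)) M] [IsManifold (𝓡 n) ∞ M] (x : M) :
    ∀ᶠ y in 𝓝 x, y ∈ frameDomain n x :=
  (trivializationAt (EuclideanSpace ℝ (Fin n)) (TangentSpace (𝓡 n) : M → Type _) x
    ).open_baseSet.mem_nhds (FiberBundle.mem_baseSet_trivializationAt' x)

theorem smooth_chartFrame {x y : M} (hy : y ∈ frameDomain n x) (i : Fin n) :
    SmoothFieldAt (chartFrame x i) y :=
  contMDiffAt_localFrame_of_mem ∞ _ _ i hy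

/-- The basis of the tangent space at `y` given by `chartFrame x`. -/
def chartBasis {x y : M} (hy : y ∈ frameDomain n x) : Module.Basis (Fin n) ℝ (Tan n y) :=
  (trivializationAt (EuclideanSpace ℝ (Fin n)) (TangentSpace (𝓡 n) : M → Type _) x).basisAt
    (EuclideanSpace.basisFun (Fin n) ℝ).toBasis hy

theorem chartBasis_apply {x y : M} (hy : y ∈ frameDomain n x) (i : Fin n) :
    chartBasis hy i = chartFrame x i y :=
  (Trivialization.localFrame_apply_of_mem_baseSet _ _ hy).symm

/-- The coefficients of tangent vectors in `chartFrame x`. -/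
def chartCoeff (x : M) (i : Fin n) (y : M) : Tan n y →ₗ[ℝ] ℝ :=
  (trivializationAt (EuclideanSpace ℝ (Fin n)) (TangentSpace (𝓡 n) : M → Type _) x
    ).localFrameCoeff (𝓡 n) (EuclideanSpace.basisFun (Fin n) ℝ).toBasis i y

theorem chartCoeff_eq {x y : M} (hy : y ∈ frameDomain n x) (i : Fin n) (v : Tan n y) :
    chartCoeff x i y v = (chartBasis hy).repr v i := by
  have := Trivialization.localFrameCoeff_apply_of_mem_baseSet (I := 𝓡 n)
    (trivializationAt (EuclideanSpace ℝ (Fin n)) (TangentSpace (𝓡 n) : M → Type _) x)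
    (EuclideanSpace.basisFun (Fin n) ℝ).toBasis hy (extendTan y v) i
  rwa [extendTan_self] at this

theorem sum_chartCoeff {x y : M} (hy : y ∈ frameDomain n x) (v : Tan n y) :
    ∑ i, chartCoeff x i y v • chartFrame x i y = v := by
  simp only [chartCoeff_eq hy, ← chartBasis_apply hy]
  exact (chartBasis hy).sum_repr v

theorem smooth_chartCoeff {V : ∀ y : M, Tan n y} (hV : SmoothFieldAt V x) (i : Fin n) :
    SmoothFunAt n (fun y => chartCoeff x i y (V y)) x :=
  contMDiffAt_localFrameCoeff (EuclideanSpace.basisFun (Fin n) ℝ).toBasis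
    (FiberBundle.mem_baseSet_trivializationAt' x) hV i

/-- The vector field `V` has germ `v` at `x`. -/
def HasFieldGerm (V : ∀ y : M, Tan n y) (v : FieldGerm n x) : Prop :=
  ∀ i, HasGerm (fun y => chartCoeff x i y (V y)) (v i)

/-- A representative of a germ of vector fields. -/
def FieldGerm.rep (v : FieldGerm n x) (y : M) : Tan n y :=
  ∑ i, FunGerm.rep (v i) y • chartFrame x i y

theorem SmoothFieldAt.sum {κ : Type*} {s : Finset κ} {V : κ → ∀ y : M, Tan n y}
    (hV : ∀ i ∈ s, SmoothFieldAt (V i) x) : SmoothFieldAt (fun y => ∑ i ∈ s, V i y) x :=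
  ContMDiffAt.sum_section hV

theorem FieldGerm.smooth_rep (v : FieldGerm n x) : SmoothFieldAt v.rep x :=
  SmoothFieldAt.sum fun i _ => SmoothFieldAt.smul (FunGerm.smooth_rep (v i))
    (smooth_chartFrame (eventually_mem_frameDomain n x).self_of_nhds i)

theorem FieldGerm.hasFieldGerm_rep (v : FieldGerm n x) : HasFieldGerm v.rep v := by
  intro i
  refine (FunGerm.hasGerm_rep (v i)).congr ?_
  filter_upwards [eventually_mem_frameDomain n x] with y hy
  simp only [FieldGerm.rep, map_sum, map_smul, chartCoeff_eq hy, ← chartBasis_apply hy,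
    Module.Basis.repr_self]
  simp [Finsupp.single_apply]

theorem SmoothFieldAt.exists_germ {V : ∀ y : M, Tan n y} (hV : SmoothFieldAt V x) :
    ∃ v : FieldGerm n x, HasFieldGerm V v := by
  choose v hv using fun i => (smooth_chartCoeff hV i).exists_germ
  exact ⟨v, hv⟩

namespace HasFieldGerm

variable {V W : ∀ y : M, Tan n y} {v w : FieldGerm n x} {f : M → ℝ} {a : FunGerm n x}

theorem eventuallyEq (hV : HasFieldGerm V v) (hW : HasFieldGerm W v) : V =ᶠ[𝓝 x] W := by
  have h : ∀ i, ∀ᶠ y in 𝓝 x, chartCoeff x i y (V y) = chartCoeff x i y (W y) :=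
    fun i => (hV i).eventuallyEq (hW i)
  filter_upwards [eventually_mem_frameDomain n x, Filter.eventually_all.2 h] with y hy hc
  rw [← sum_chartCoeff hy (V y), ← sum_chartCoeff hy (W y)]
  exact Finset.sum_congr rfl fun i _ => by rw [hc i]

theorem congr (hV : HasFieldGerm V v) (hVW : W =ᶠ[𝓝 x] V) : HasFieldGerm W v := fun i =>
  (hV i).congr (hVW.mono fun y hy => by simp only [hy])

theorem unique (hV : HasFieldGerm V v) (hW : HasFieldGerm W w) (h : V =ᶠ[𝓝 x] W) : v = w :=
  funext fun i => (hV i).unique (hW i) (h.mono fun y hy => by simp only [hy])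

theorem smooth (hV : HasFieldGerm V v) : SmoothFieldAt V x :=
  ContMDiffAt.congr_of_eventuallyEq v.smooth_rep
    ((hV.eventuallyEq v.hasFieldGerm_rep).mono fun y hy => by simp only [hy])

theorem add (hV : HasFieldGerm V v) (hW : HasFieldGerm W w) : HasFieldGerm (V + W) (v + w) :=
  fun i => ((hV i).add (hW i)).congr (Filter.Eventually.of_forall fun y => by simp)

theorem neg (hV : HasFieldGerm V v) : HasFieldGerm (-V) (-v) :=
  fun i => (hV i).neg.congr (Filter.Eventually.of_forall fun y => by simp)

theorem sub (hV : HasFieldGerm V v) (hW : HasFieldGerm W w) : HasFieldGerm (V - W) (v - w) :=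
  fun i => ((hV i).sub (hW i)).congr (Filter.Eventually.of_forall fun y => by simp)

theorem smul (hf : HasGerm f a) (hV : HasFieldGerm V v) : HasFieldGerm (f • V) (a • v) :=
  fun i => (hf.mul (hV i)).congr (Filter.Eventually.of_forall fun y => by simp)

theorem sum {κ : Type*} {s : Finset κ} {V : κ → ∀ y : M, Tan n y} {v : κ → FieldGerm n x}
    (hV : ∀ i ∈ s, HasFieldGerm (V i) (v i)) :
    HasFieldGerm (fun y => ∑ i ∈ s, V i y) (∑ i ∈ s, v i) := fun i => by
  rw [Finset.sum_apply]
  exact (HasGerm.sum fun j hj => hV j hj i).congr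
    (Filter.Eventually.of_forall fun y => by simp)

theorem chartFrame (i : Fin n) : HasFieldGerm (chartFrame x i) (Pi.single i 1 : FieldGerm n x) := by
  intro j
  by_cases h : j = i
  · subst h
    rw [Pi.single_eq_same]
    refine HasGerm.one.congr ?_
    filter_upwards [eventually_mem_frameDomain n x] with y hy
    simp [chartCoeff_eq hy, ← chartBasis_apply hy]
  · rw [Pi.single_eq_of_ne h]
    refine HasGerm.zero.congr ?_
    filter_upwards [eventually_mem_frameDomain n x] with y hy
    simp [chartCoeff_eq hy, ← chartBasis_apply hy, Ne.symm h]

theorem apply_eq (hV : HasFieldGerm V v) :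
    V x = ∑ i, FunGerm.value (v i) • _root_.chartFrame x i x := by
  rw [← sum_chartCoeff (eventually_mem_frameDomain n x).self_of_nhds (V x)]
  exact Finset.sum_congr rfl fun i _ => by rw [(hV i).value]

end HasFieldGerm

end Germs

/-! ### The Lie–Rinehart algebra of germs -/

section GermAlgebra

variable {n : ℕ} {M : Type*} [TopologicalSpace M] [ChartedSpace (EuclideanSpace ℝ (Fin n)) M]
  [IsManifold (𝓡 n) ∞ M] (g : SemiRiemannianMetric n M) {x : M}

theorem exists_germ_dirDeriv (v : FieldGerm n x) (a : FunGerm n x) :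
    ∃ c : FunGerm n x, HasGerm (dirDeriv v.rep a.rep) c :=
  (smoothFunAt_dirDeriv v.smooth_rep a.smooth_rep).exists_germ

theorem exists_germ_mlieBracket (v w : FieldGerm n x) :
    ∃ u : FieldGerm n x, HasFieldGerm (mlieBracket (𝓡 n) v.rep w.rep) u :=
  (v.smooth_rep.mlieBracket w.smooth_rep).exists_germ

theorem exists_germ_innerFields (v w : FieldGerm n x) :
    ∃ c : FunGerm n x, HasGerm (g.innerFields v.rep w.rep) c :=
  SmoothFunAt.exists_germ (g.smooth_innerFields v.smooth_rep w.smooth_rep)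

/-- The derivative of a germ of functions along a germ of vector fields. -/
def germAct (v : FieldGerm n x) (a : FunGerm n x) : FunGerm n x :=
  (exists_germ_dirDeriv v a).choose

/-- The Lie bracket of germs of vector fields. -/
def germBracket (v w : FieldGerm n x) : FieldGerm n x :=
  (exists_germ_mlieBracket v w).choose

/-- The metric on germs of vector fields. -/
def germInner (v w : FieldGerm n x) : FunGerm n x := (exists_germ_innerFields g v w).choose

variable {U V W : ∀ y : M, Tan n y} {u v w : FieldGerm n x} {f : M → ℝ} {a : FunGerm n x}

theorem HasFieldGerm.dirDeriv (hV : HasFieldGerm V v) (hf : HasGerm f a) :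
    HasGerm (dirDeriv V f) (germAct v a) := by
  refine (exists_germ_dirDeriv v a).choose_spec.congr ?_
  filter_upwards [hV.eventuallyEq v.hasFieldGerm_rep,
    (hf.eventuallyEq a.hasGerm_rep).eventuallyEq_nhds] with y h1 h2
  exact dirDeriv_congr h1 h2

theorem HasFieldGerm.mlieBracket (hV : HasFieldGerm V v) (hW : HasFieldGerm W w) :
    HasFieldGerm (mlieBracket (𝓡 n) V W) (germBracket v w) :=
  (exists_germ_mlieBracket v w).choose_spec.congr
    (Filter.EventuallyEq.mlieBracket_vectorField (hV.eventuallyEq v.hasFieldGerm_rep)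
      (hW.eventuallyEq w.hasFieldGerm_rep))

theorem HasFieldGerm.innerFields' (hV : HasFieldGerm V v) (hW : HasFieldGerm W w) :
    HasGerm (g.innerFields V W) (germInner g v w) := by
  refine (exists_germ_innerFields g v w).choose_spec.congr ?_
  filter_upwards [hV.eventuallyEq v.hasFieldGerm_rep, hW.eventuallyEq w.hasFieldGerm_rep]
    with y h1 h2
  simp only [SemiRiemannianMetric.innerFields, h1, h2]

/-- The metric on germs as a bilinear form. -/
def germForm (x : M) : FieldGerm n x →ₗ[FunGerm n x] FieldGerm n x →ₗ[FunGerm n x] FunGerm n x :=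
  LinearMap.mk₂ _ (germInner g)
    (fun u v w => ((u.hasFieldGerm_rep.add v.hasFieldGerm_rep).innerFields' g
      w.hasFieldGerm_rep).unique ((u.hasFieldGerm_rep.innerFields' g w.hasFieldGerm_rep).add
        (v.hasFieldGerm_rep.innerFields' g w.hasFieldGerm_rep))
      (Filter.Eventually.of_forall fun y => by rw [g.add_innerFields]))
    (fun a v w => ((HasFieldGerm.smul a.hasGerm_rep v.hasFieldGerm_rep).innerFields' g
      w.hasFieldGerm_rep).unique
        (a.hasGerm_rep.mul (v.hasFieldGerm_rep.innerFields' g w.hasFieldGerm_rep))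
      (Filter.Eventually.of_forall fun y => by rw [g.smul_innerFields]))
    (fun w u v => (w.hasFieldGerm_rep.innerFields' g
      (u.hasFieldGerm_rep.add v.hasFieldGerm_rep)).unique
        ((w.hasFieldGerm_rep.innerFields' g u.hasFieldGerm_rep).add
        (w.hasFieldGerm_rep.innerFields' g v.hasFieldGerm_rep))
      (Filter.Eventually.of_forall fun y => by rw [g.innerFields_add]))
    (fun a w v => (w.hasFieldGerm_rep.innerFields' g
      (HasFieldGerm.smul a.hasGerm_rep v.hasFieldGerm_rep)).unique
        (a.hasGerm_rep.mul (w.hasFieldGerm_rep.innerFields' g v.hasFieldGerm_rep))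
      (Filter.Eventually.of_forall fun y => by rw [g.innerFields_smul]))

theorem HasFieldGerm.innerFields (hV : HasFieldGerm V v) (hW : HasFieldGerm W w) :
    HasGerm (g.innerFields V W) (germForm g x v w) := hV.innerFields' g hW

/-- The Gram matrix of the chart frame. -/
def gramMatrix (x : M) : Matrix (Fin n) (Fin n) (FunGerm n x) :=
  fun i j => germForm g x (Pi.single i 1) (Pi.single j 1)

/-- The Gram determinant does not vanish at the base point, hence it is a unit of the local ring of
germs: this yields the dual frame. -/
theorem isUnit_det_gramMatrix (x : M) : IsUnit (gramMatrix g x).det := by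
  refine FunGerm.isUnit ?_
  have hx := (eventually_mem_frameDomain n x).self_of_nhds
  have h : FunGerm.value.mapMatrix (gramMatrix g x)
      = LinearMap.BilinForm.toMatrix (chartBasis hx) (g.form x) := by
    ext i j
    rw [LinearMap.BilinForm.toMatrix_apply, chartBasis_apply, chartBasis_apply]
    exact ((HasFieldGerm.chartFrame i).innerFields g (HasFieldGerm.chartFrame j)).value
  rw [RingHom.map_det, h]
  exact (LinearMap.BilinForm.nondegenerate_iff_det_ne_zero _).1 (g.form_nondegenerate x)

/-- The frame dual to the chart frame. -/
def germDual (x : M) (j : Fin n) : FieldGerm n x := fun i => (gramMatrix g x)⁻¹ i j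

theorem germForm_single_dual (x : M) (i j : Fin n) :
    germForm g x (Pi.single i 1) (germDual g x j) = if i = j then 1 else 0 := by
  have h := congrFun (congrFun (Matrix.mul_nonsing_inv _ (isUnit_det_gramMatrix g x)) i) j
  rw [Matrix.mul_apply, Matrix.one_apply] at h
  rw [← h]
  conv_lhs => rw [pi_eq_sum_univ' (germDual g x j)]
  simp only [map_sum, map_smul, smul_eq_mul]
  refine Finset.sum_congr rfl fun k _ => ?_
  exact mul_comm _ _

theorem sum_germForm_dual (v : FieldGerm n x) :
    ∑ i, germForm g x v (germDual g x i) • (Pi.single i 1 : FieldGerm n x) = v := by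
  have h : ∀ i, germForm g x v (germDual g x i) = v i := fun i => by
    conv_lhs => rw [pi_eq_sum_univ' v]
    simp only [map_sum, LinearMap.sum_apply, map_smul, LinearMap.smul_apply, smul_eq_mul,
      germForm_single_dual]
    simp
  simp only [h]
  ext j
  simp [Pi.single_apply]

theorem germBracket_add (u v w : FieldGerm n x) :
    germBracket u (v + w) = germBracket u v + germBracket u w :=
  (u.hasFieldGerm_rep.mlieBracket (v.hasFieldGerm_rep.add w.hasFieldGerm_rep)).unique
    ((u.hasFieldGerm_rep.mlieBracket v.hasFieldGerm_rep).add
      (u.hasFieldGerm_rep.mlieBracket w.hasFieldGerm_rep))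
    (by filter_upwards [v.smooth_rep.eventually_diff, w.smooth_rep.eventually_diff] with y h1 h2
        exact mlieBracket_add_right h1 h2)

theorem germBracket_smul (u : FieldGerm n x) (a : FunGerm n x) (v : FieldGerm n x) :
    germBracket u (a • v) = germAct u a • v + a • germBracket u v :=
  (u.hasFieldGerm_rep.mlieBracket (HasFieldGerm.smul a.hasGerm_rep v.hasFieldGerm_rep)).unique
    ((HasFieldGerm.smul (u.hasFieldGerm_rep.dirDeriv a.hasGerm_rep) v.hasFieldGerm_rep).add
      (HasFieldGerm.smul a.hasGerm_rep (u.hasFieldGerm_rep.mlieBracket v.hasFieldGerm_rep)))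
    (by filter_upwards [a.smooth_rep.eventually_diff, v.smooth_rep.eventually_diff] with y h1 h2
        exact mlieBracket_smul h1 h2)

theorem germBracket_jacobi (u v w : FieldGerm n x) : germBracket u (germBracket v w)
    = germBracket (germBracket u v) w + germBracket v (germBracket u w) :=
  (u.hasFieldGerm_rep.mlieBracket (v.hasFieldGerm_rep.mlieBracket w.hasFieldGerm_rep)).unique
    (((u.hasFieldGerm_rep.mlieBracket v.hasFieldGerm_rep).mlieBracket w.hasFieldGerm_rep).add
      (v.hasFieldGerm_rep.mlieBracket (u.hasFieldGerm_rep.mlieBracket w.hasFieldGerm_rep)))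
    (by filter_upwards [u.smooth_rep.eventually_two, v.smooth_rep.eventually_two,
          w.smooth_rep.eventually_two] with y h1 h2 h3
        rw [← minSmoothness_of_isRCLikeNormedField (𝕜 := ℝ) (n := 2)] at h1 h2 h3
        exact leibniz_identity_mlieBracket_apply h1 h2 h3)

theorem smul_germAct (a : FunGerm n x) (u : FieldGerm n x) (c : FunGerm n x) :
    germAct (a • u) c = a * germAct u c :=
  ((HasFieldGerm.smul a.hasGerm_rep u.hasFieldGerm_rep).dirDeriv c.hasGerm_rep).unique
    (a.hasGerm_rep.mul (u.hasFieldGerm_rep.dirDeriv c.hasGerm_rep))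
    (Filter.Eventually.of_forall fun _ => smul_dirDeriv _ _)

/-- The bracket acts on functions as the commutator: this follows from the Jacobi identity in which
the third vector field is multiplied by the function. -/
theorem germAct_bracket (u v : FieldGerm n x) (a : FunGerm n x) :
    germAct (germBracket u v) a = germAct u (germAct v a) - germAct v (germAct u a) := by
  -- in dimension `0` there is no vector field to test with, but all derivatives vanish
  rcases isEmpty_or_nonempty (Fin n) with hn | ⟨⟨i⟩⟩
  · have h : ∀ (w : FieldGerm n x) c, germAct w c = 0 := fun w c => by
      rw [Subsingleton.elim w ((0 : FunGerm n x) • w), smul_germAct, zero_mul]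
    rw [h, h, h, sub_zero]
  have h := germBracket_jacobi u v (a • (Pi.single i 1 : FieldGerm n x))
  simp only [germBracket_smul, germBracket_add, germBracket_jacobi u v (Pi.single i 1)] at h
  have hz : (germAct (germBracket u v) a - (germAct u (germAct v a) - germAct v (germAct u a)))
      • (Pi.single i 1 : FieldGerm n x) = 0 := by
    linear_combination (norm := module) -h
  have hi := congrFun hz i
  rw [Pi.smul_apply, Pi.single_eq_same, smul_eq_mul, mul_one, Pi.zero_apply] at hi
  exact sub_eq_zero.mp hi

/-- The Lie–Rinehart algebra of germs at `x` of functions and vector fields, with its metric. -/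
def germAlgebra (x : M) : MetricLieRinehart (FunGerm n x) (FieldGerm n x) (Fin n) where
  act := germAct
  act_add_left u v a := ((u.hasFieldGerm_rep.add v.hasFieldGerm_rep).dirDeriv a.hasGerm_rep).unique
    ((u.hasFieldGerm_rep.dirDeriv a.hasGerm_rep).add (v.hasFieldGerm_rep.dirDeriv a.hasGerm_rep))
    (Filter.Eventually.of_forall fun _ => add_dirDeriv _)
  act_smul_left := smul_germAct
  act_add u a c := (u.hasFieldGerm_rep.dirDeriv (a.hasGerm_rep.add c.hasGerm_rep)).unique
    ((u.hasFieldGerm_rep.dirDeriv a.hasGerm_rep).add (u.hasFieldGerm_rep.dirDeriv c.hasGerm_rep))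
    (by filter_upwards [a.smooth_rep.eventually_diff, c.smooth_rep.eventually_diff] with y h1 h2
        exact dirDeriv_add h1 h2)
  act_mul u a c := (u.hasFieldGerm_rep.dirDeriv (a.hasGerm_rep.mul c.hasGerm_rep)).unique
    (((u.hasFieldGerm_rep.dirDeriv a.hasGerm_rep).mul c.hasGerm_rep).add
      (a.hasGerm_rep.mul (u.hasFieldGerm_rep.dirDeriv c.hasGerm_rep)))
    (by filter_upwards [a.smooth_rep.eventually_diff, c.smooth_rep.eventually_diff] with y h1 h2
        exact dirDeriv_mul h1 h2)
  br := germBracket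
  br_skew u v := (u.hasFieldGerm_rep.mlieBracket v.hasFieldGerm_rep).unique
    (v.hasFieldGerm_rep.mlieBracket u.hasFieldGerm_rep).neg
    (Filter.Eventually.of_forall fun _ => mlieBracket_swap_apply)
  br_add := germBracket_add
  br_smul := germBracket_smul
  act_br := germAct_bracket
  jacobi := germBracket_jacobi
  g := germForm g x
  g_symm u v := (u.hasFieldGerm_rep.innerFields g v.hasFieldGerm_rep).unique
    (v.hasFieldGerm_rep.innerFields g u.hasFieldGerm_rep) (by rw [g.innerFields_comm])
  frame i := Pi.single i 1
  dual := germDual g x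
  sum_frame := sum_germForm_dual g
  g_frame_dual := germForm_single_dual g x

end GermAlgebra

/-! ### Multilinearity over the ring of germs -/

namespace MetricLieRinehart

variable {A X ι : Type*} [CommRing A] [AddCommGroup X] [Module A X] [Fintype ι] [DecidableEq ι]
  (L : MetricLieRinehart A X ι)

/-- The exterior derivative of the 1-form `g(y, ·)` as a bilinear form. -/
def dFlatLin (y : X) : X →ₗ[A] X →ₗ[A] A :=
  LinearMap.mk₂ A (L.dFlat y)
    (fun u u' v => by
      simp only [dFlat, L.act_add_left, map_add, L.act_add, L.add_br]; ring)
    (fun a u v => by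
      simp only [dFlat, L.act_smul_left, map_sub, map_smul, smul_eq_mul, L.act_mul, L.smul_br]
      ring)
    (fun u v v' => by
      simp only [dFlat, L.act_add_left, map_add, L.act_add, L.br_add]; ring)
    (fun a u v => by
      simp only [dFlat, L.act_smul_left, map_add, map_smul, smul_eq_mul, L.act_mul, L.br_smul]
      ring)

variable [Invertible (2 : A)]

/-- The curvature operator as a trilinear map. -/
def curvLin : X →ₗ[A] X →ₗ[A] X →ₗ[A] X :=
  LinearMap.mk₂ A (fun u v =>
      { toFun := L.curv u v
        map_add' := L.curv_add u v
        map_smul' := L.curv_smul u v })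
    (fun _ _ _ => LinearMap.ext fun _ => L.add_curv _ _ _ _)
    (fun _ _ _ => LinearMap.ext fun _ => L.smul_curv _ _ _ _)
    (fun _ _ _ => LinearMap.ext fun _ => L.curv_add_mid _ _ _ _)
    (fun _ _ _ => LinearMap.ext fun _ => L.curv_smul_mid _ _ _ _)

theorem curvLin_apply (u v w : X) : L.curvLin u v w = L.curv u v w := rfl

/-- The covariant derivative of a bilinear form as a trilinear form. -/
def nabFormLin (T : X →ₗ[A] X →ₗ[A] A) : X →ₗ[A] X →ₗ[A] X →ₗ[A] A :=
  LinearMap.mk₂ A (fun z v =>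
      { toFun := L.nabForm (fun p q => T p q) z v
        map_add' := fun w w' => by simp only [nabForm, map_add, L.act_add, L.nab_add]; ring
        map_smul' := fun a w => by
          simp only [nabForm, map_add, map_smul, smul_eq_mul, L.act_mul, L.nab_smul,
            RingHom.id_apply]; ring })
    (fun z z' v => LinearMap.ext fun w => by
      simp only [nabForm, LinearMap.coe_mk, AddHom.coe_mk, LinearMap.add_apply, map_add,
        L.act_add_left, L.add_nab]; ring)
    (fun a z v => LinearMap.ext fun w => by
      simp only [nabForm, LinearMap.coe_mk, AddHom.coe_mk, LinearMap.smul_apply, map_smul,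
        L.act_smul_left, L.smul_nab, smul_eq_mul]; ring)
    (fun z v v' => LinearMap.ext fun w => by
      simp only [nabForm, LinearMap.coe_mk, AddHom.coe_mk, LinearMap.add_apply, map_add,
        L.act_add, L.nab_add]; ring)
    (fun a z v => LinearMap.ext fun w => by
      simp only [nabForm, LinearMap.coe_mk, AddHom.coe_mk, LinearMap.add_apply,
        LinearMap.smul_apply, map_add, map_smul, L.act_mul, L.nab_smul, smul_eq_mul]; ring)

end MetricLieRinehart

/-! ### Evaluation of germs at their base point -/

section Evaluation

variable {n : ℕ} {M : Type*} [TopologicalSpace M] [ChartedSpace (EuclideanSpace ℝ (Fin n)) M]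
  [IsManifold (𝓡 n) ∞ M] {x : M}

/-- The basis of the tangent space at `x` given by the chart frame at `x`. -/
def tanBasis (x : M) : Module.Basis (Fin n) ℝ (Tan n x) :=
  chartBasis (eventually_mem_frameDomain n x).self_of_nhds

theorem tanBasis_apply (x : M) (i : Fin n) : tanBasis x i = chartFrame x i x := chartBasis_apply _ i

/-- The value at `x` of a germ of vector fields at `x`, as a semilinear map. -/
def fieldValue (x : M) : FieldGerm n x →ₛₗ[(FunGerm.value : FunGerm n x →+* ℝ)] Tan n x where
  toFun v := ∑ i, FunGerm.value (v i) • chartFrame x i x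
  map_add' u v := by simp [add_smul, Finset.sum_add_distrib]
  map_smul' a v := by simp [mul_smul, Finset.smul_sum]

theorem HasFieldGerm.fieldValue {V : ∀ y : M, Tan n y} {v : FieldGerm n x}
    (hV : HasFieldGerm V v) : fieldValue x v = V x := hV.apply_eq.symm

variable {P Q : Type*} [AddCommGroup P] [Module (FunGerm n x) P] [AddCommGroup Q] [Module ℝ Q]

/-- A map that is linear over the ring of germs induces a linear map on the tangent space. Iterated,
this turns tensorial operations on germs into tensors. -/
def evalLin (val : P →ₛₗ[(FunGerm.value : FunGerm n x →+* ℝ)] Q) :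
    (FieldGerm n x →ₗ[FunGerm n x] P) →ₛₗ[(FunGerm.value : FunGerm n x →+* ℝ)]
      (Tan n x →ₗ[ℝ] Q) where
  toFun B := (tanBasis x).constr ℝ fun i => val (B (Pi.single i 1))
  map_add' B B' := (tanBasis x).ext fun i => by
    simp only [LinearMap.add_apply, Module.Basis.constr_basis, map_add]
  map_smul' a B := (tanBasis x).ext fun i => by
    simp only [LinearMap.smul_apply, Module.Basis.constr_basis, LinearMap.map_smulₛₗ]

theorem evalLin_apply (val : P →ₛₗ[(FunGerm.value : FunGerm n x →+* ℝ)] Q)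
    (B : FieldGerm n x →ₗ[FunGerm n x] P) {V : ∀ y : M, Tan n y} {v : FieldGerm n x}
    (hV : HasFieldGerm V v) : evalLin val B (V x) = val (B v) := by
  rw [hV.apply_eq]
  conv_rhs => rw [pi_eq_sum_univ' v]
  simp only [map_sum, map_smul, LinearMap.map_smulₛₗ, evalLin, LinearMap.coe_mk, AddHom.coe_mk,
    ← tanBasis_apply, Module.Basis.constr_basis]

end Evaluation

/-! ### Germs of the geometric tensors -/

namespace SemiRiemannianMetric

variable {n : ℕ} {M : Type*} [TopologicalSpace M] [ChartedSpace (EuclideanSpace ℝ (Fin n)) M]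
  [IsManifold (𝓡 n) ∞ M] (g : SemiRiemannianMetric n M) {x : M} {U V W : ∀ y : M, Tan n y}
  {u v w : FieldGerm n x}

/-- Germs compute the Koszul formula. -/
theorem hasGerm_koszul (hU : HasFieldGerm U u) (hV : HasFieldGerm V v) (hW : HasFieldGerm W w) :
    HasGerm (g.koszul U V W) ((germAlgebra g x).g ((germAlgebra g x).nab u v) w) := by
  obtain ⟨c, hc⟩ : ∃ c, c = (germAlgebra g x).g ((germAlgebra g x).nab u v) w := ⟨_, rfl⟩
  rw [← hc]
  have h1 : HasGerm (fun y => 2 * c.rep y) (2 * c) := HasGerm.two.mul c.hasGerm_rep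
  have h1' : 2 * c = (germAlgebra g x).kos u v w := by rw [hc, (germAlgebra g x).g_nab]
  rw [h1'] at h1
  have h2 := (((((hU.dirDeriv (hV.innerFields g hW)).add (hV.dirDeriv (hW.innerFields g hU))).sub
    (hW.dirDeriv (hU.innerFields g hV))).add ((hU.mlieBracket hV).innerFields g hW)).sub
    ((hU.mlieBracket hW).innerFields g hV)).sub ((hV.mlieBracket hW).innerFields g hU)
  refine c.hasGerm_rep.congr ?_
  filter_upwards [h2.eventuallyEq h1] with y hy
  rw [koszul]
  simp only [innerFields] at hy ⊢
  rw [hy, mul_div_cancel_left₀ _ two_ne_zero]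

theorem eq_of_inner {u v : Tan n x} (h : ∀ w, g.inner x u w = g.inner x v w) : u = v :=
  sub_eq_zero.mp (g.nondegenerate x _ fun w => by
    rw [map_sub, sub_apply, h, sub_self])

theorem eq_of_inner_basis {y : M} {ι : Type*} (b : Module.Basis ι ℝ (Tan n y)) {u v : Tan n y}
    (h : ∀ i, g.inner y u (b i) = g.inner y v (b i)) : u = v :=
  g.eq_of_inner fun w => LinearMap.congr_fun
    (b.ext h : (g.inner y u).toLinearMap = (g.inner y v).toLinearMap) w

/-- The Levi-Civita connection on germs is the one of the algebra of germs. -/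
theorem hasFieldGerm_nablaField (hU : HasFieldGerm U u) (hV : HasFieldGerm V v) :
    HasFieldGerm (g.nablaField U V) ((germAlgebra g x).nab u v) := by
  set N := (germAlgebra g x).nab u v with hN
  refine N.hasFieldGerm_rep.congr ?_
  have h : ∀ i, ∀ᶠ y in 𝓝 x,
      g.koszul U V (chartFrame x i) y = g.inner y (N.rep y) (chartFrame x i y) := fun i =>
    (g.hasGerm_koszul hU hV (HasFieldGerm.chartFrame i)).eventuallyEq
      (N.hasFieldGerm_rep.innerFields g (HasFieldGerm.chartFrame i))
  filter_upwards [Filter.eventually_all.2 h, eventually_mem_frameDomain n x,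
    hU.smooth.eventually_diff, hV.smooth.eventually_diff] with y h1 hy hU hV
  refine g.eq_of_inner_basis (chartBasis hy) fun i => ?_
  rw [chartBasis_apply, ← h1 i, nablaField, g.inner_nabla hU hV (smooth_chartFrame hy i).diff]

theorem hasFieldGerm_curvatureField (hU : HasFieldGerm U u) (hV : HasFieldGerm V v)
    (hW : HasFieldGerm W w) :
    HasFieldGerm (g.curvatureField U V W) ((germAlgebra g x).curv u v w) :=
  ((g.hasFieldGerm_nablaField hU (g.hasFieldGerm_nablaField hV hW)).sub
    (g.hasFieldGerm_nablaField hV (g.hasFieldGerm_nablaField hU hW))).sub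
    (g.hasFieldGerm_nablaField (hU.mlieBracket hV) hW)

/-- The tensor `g.riemann` computes the curvature operator; a tensor with this property exists
because the curvature is trilinear over the ring of germs. -/
theorem riemann_apply (hU : SmoothFieldAt U x) (hV : SmoothFieldAt V x) (hW : SmoothFieldAt W x) :
    g.riemann x (U x) (V x) (W x) = g.curvatureField U V W x := by
  refine Classical.epsilon_spec
    (p := fun R : Tan n x →ₗ[ℝ] Tan n x →ₗ[ℝ] Tan n x →ₗ[ℝ] Tan n x =>
      ∀ U V W : ∀ y : M, Tan n y, SmoothFieldAt U x → SmoothFieldAt V x → SmoothFieldAt W x →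
        R (U x) (V x) (W x) = g.curvatureField U V W x)
    ⟨evalLin (evalLin (evalLin (fieldValue x))) (germAlgebra g x).curvLin,
      fun U V W hU hV hW => ?_⟩ U V W hU hV hW
  obtain ⟨u, hu⟩ := hU.exists_germ
  obtain ⟨v, hv⟩ := hV.exists_germ
  obtain ⟨w, hw⟩ := hW.exists_germ
  rw [evalLin_apply _ _ hu, evalLin_apply _ _ hv, evalLin_apply _ _ hw]
  exact (g.hasFieldGerm_curvatureField hu hv hw).fieldValue

end SemiRiemannianMetric

section Criterion

variable {n : ℕ} {M : Type*} [TopologicalSpace M] [ChartedSpace (EuclideanSpace ℝ (Fin n)) M]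
  [IsManifold (𝓡 n) ∞ M] {x : M} {V : ∀ y : M, Tan n y} {v : FieldGerm n x}

/-- A field of linear forms has the germ of an `A`-linear form if this holds on the chart frame. The
frame is smooth on a neighbourhood of `x`, while a field that is smooth at `x` need only be
differentiable to finite order at each nearby point: the tensors that are characterized by their
values on smooth fields are therefore first evaluated on the frame. -/
theorem hasGerm_of_chartFrame {φ : ∀ y : M, Tan n y →ₗ[ℝ] ℝ}
    {B : FieldGerm n x →ₗ[FunGerm n x] FunGerm n x}
    (h : ∀ i, HasGerm (fun y => φ y (chartFrame x i y)) (B (Pi.single i 1)))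
    (hV : HasFieldGerm V v) : HasGerm (fun y => φ y (V y)) (B v) := by
  rw [pi_eq_sum_univ' v]
  simp only [map_sum, map_smul, smul_eq_mul]
  refine (HasGerm.sum fun i _ => (hV i).mul (h i)).congr ?_
  filter_upwards [eventually_mem_frameDomain n x] with y hy
  conv_lhs => rw [← sum_chartCoeff hy (V y)]
  simp

/-- A field of endomorphisms has the germ of an `A`-linear endomorphism if this holds on the chart
frame. -/
theorem hasFieldGerm_of_chartFrame {φ : ∀ y : M, Tan n y →ₗ[ℝ] Tan n y}
    {B : FieldGerm n x →ₗ[FunGerm n x] FieldGerm n x}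
    (h : ∀ i, HasFieldGerm (fun y => φ y (chartFrame x i y)) (B (Pi.single i 1)))
    (hV : HasFieldGerm V v) : HasFieldGerm (fun y => φ y (V y)) (B v) := by
  rw [pi_eq_sum_univ' v]
  simp only [map_sum, map_smul]
  refine (HasFieldGerm.sum fun i _ => HasFieldGerm.smul (hV i) (h i)).congr ?_
  filter_upwards [eventually_mem_frameDomain n x] with y hy
  conv_lhs => rw [← sum_chartCoeff hy (V y)]
  simp only [map_sum, map_smul]
  rfl

end Criterion

namespace SemiRiemannianMetric

variable {n : ℕ} {M : Type*} [TopologicalSpace M] [ChartedSpace (EuclideanSpace ℝ (Fin n)) M]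
  [IsManifold (𝓡 n) ∞ M] (g : SemiRiemannianMetric n M) {x : M} {U V W Y : ∀ y : M, Tan n y}
  {u v w q : FieldGerm n x}

theorem hasFieldGerm_riemann (hU : HasFieldGerm U u) (hV : HasFieldGerm V v)
    (hW : HasFieldGerm W w) :
    HasFieldGerm (fun y => g.riemann y (U y) (V y) (W y)) ((germAlgebra g x).curv u v w) := by
  rw [← MetricLieRinehart.curvLin_apply]
  have h1 : ∀ i j k, HasFieldGerm
      (fun y => g.riemann y (chartFrame x i y) (chartFrame x j y) (chartFrame x k y))
      ((germAlgebra g x).curvLin (Pi.single i 1) (Pi.single j 1) (Pi.single k 1)) := by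
    intro i j k
    rw [MetricLieRinehart.curvLin_apply]
    refine (g.hasFieldGerm_curvatureField (HasFieldGerm.chartFrame i) (HasFieldGerm.chartFrame j)
      (HasFieldGerm.chartFrame k)).congr ?_
    filter_upwards [eventually_mem_frameDomain n x] with y hy
    exact g.riemann_apply (smooth_chartFrame hy i) (smooth_chartFrame hy j)
      (smooth_chartFrame hy k)
  generalize (germAlgebra g x).curvLin = C at h1 ⊢
  have h2 : ∀ i j, HasFieldGerm
      (fun y => g.riemann y (chartFrame x i y) (chartFrame x j y) (W y))
      (C (Pi.single i 1) (Pi.single j 1) w) := fun i j =>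
    hasFieldGerm_of_chartFrame (φ := fun y => g.riemann y (chartFrame x i y) (chartFrame x j y))
      (B := C (Pi.single i 1) (Pi.single j 1)) (h1 i j) hW
  have h3 : ∀ i, HasFieldGerm (fun y => g.riemann y (chartFrame x i y) (V y) (W y))
      (C (Pi.single i 1) v w) := fun i =>
    hasFieldGerm_of_chartFrame (φ := fun y => (g.riemann y (chartFrame x i y)).flip (W y))
      (B := (C (Pi.single i 1)).flip w) (h2 i) hV
  exact hasFieldGerm_of_chartFrame (φ := fun y => ((g.riemann y).flip (V y)).flip (W y))
      (B := (C.flip v).flip w) h3 hU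

/-- The trace of an endomorphism, in terms of a basis and its dual basis for the metric. -/
theorem trace_eq_sum {y : M} (b : Module.Basis (Fin n) ℝ (Tan n y)) {d : Fin n → Tan n y}
    (hd : ∀ i j, g.inner y (b i) (d j) = if i = j then 1 else 0) (T : Tan n y →ₗ[ℝ] Tan n y) :
    LinearMap.trace ℝ (Tan n y) T = ∑ i, g.inner y (T (b i)) (d i) := by
  rw [LinearMap.trace_eq_matrix_trace ℝ b, Matrix.trace]
  refine Finset.sum_congr rfl fun i _ => ?_
  rw [Matrix.diag_apply, LinearMap.toMatrix_apply]
  conv_rhs => rw [← b.sum_repr (T (b i))]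
  simp only [map_sum, map_smul, FunLike.coe_sum, FunLike.coe_smul, Finset.sum_apply,
    Pi.smul_apply, hd]
  simp

theorem metricTrace_eq_sum {y : M} (b : Module.Basis (Fin n) ℝ (Tan n y)) {d : Fin n → Tan n y}
    (hd : ∀ i j, g.inner y (b i) (d j) = if i = j then 1 else 0)
    (B : LinearMap.BilinForm ℝ (Tan n y)) : g.metricTrace y B = ∑ i, B (d i) (b i) := by
  rw [metricTrace, g.trace_eq_sum b hd]
  exact Finset.sum_congr rfl fun i _ => by rw [g.symm, g.inner_endo]

/-- Representatives of the frame dual to the chart frame. -/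
def dualFrame (x : M) (i : Fin n) : ∀ y : M, Tan n y := (germDual g x i).rep

theorem hasFieldGerm_dualFrame (i : Fin n) :
    HasFieldGerm (g.dualFrame x i) ((germAlgebra g x).dual i) :=
  FieldGerm.hasFieldGerm_rep _

theorem eventually_inner_dualFrame (x : M) : ∀ᶠ y in 𝓝 x, ∀ i j,
    g.inner y (chartFrame x i y) (g.dualFrame x j y) = if i = j then 1 else 0 := by
  refine Filter.eventually_all.2 fun i => Filter.eventually_all.2 fun j => ?_
  have h1 := (HasFieldGerm.chartFrame i).innerFields g (g.hasFieldGerm_dualFrame (x := x) j)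
  have h2 : germForm g x (Pi.single i 1) ((germAlgebra g x).dual j) = if i = j then 1 else 0 :=
    germForm_single_dual g x i j
  rw [h2] at h1
  split_ifs with h
  · rw [if_pos h] at h1; exact h1.eventuallyEq HasGerm.one
  · rw [if_neg h] at h1; exact h1.eventuallyEq HasGerm.zero

theorem hasGerm_ricci (hV : HasFieldGerm V v) (hW : HasFieldGerm W w) :
    HasGerm (fun y => g.ricci y (V y) (W y)) ((germAlgebra g x).ric v w) := by
  rw [MetricLieRinehart.ric_apply]
  refine (HasGerm.sum fun i _ => (g.hasFieldGerm_riemann (HasFieldGerm.chartFrame i) hV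
    hW).innerFields g (g.hasFieldGerm_dualFrame i)).congr ?_
  filter_upwards [eventually_mem_frameDomain n x, g.eventually_inner_dualFrame x] with y hy hd
  simp only [← chartBasis_apply hy] at hd
  refine (g.trace_eq_sum (chartBasis hy) hd _).trans ?_
  simp only [chartBasis_apply]
  rfl

theorem hasGerm_scalarCurvature (x : M) :
    HasGerm g.scalarCurvature (germAlgebra g x).scal := by
  rw [MetricLieRinehart.scal, MetricLieRinehart.sum_frame_dual_comm]
  refine (HasGerm.sum fun i _ => g.hasGerm_ricci (g.hasFieldGerm_dualFrame i)
    (HasFieldGerm.chartFrame i)).congr ?_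
  filter_upwards [eventually_mem_frameDomain n x, g.eventually_inner_dualFrame x] with y hy hd
  simp only [← chartBasis_apply hy] at hd
  refine (g.metricTrace_eq_sum (chartBasis hy) hd _).trans ?_
  simp only [chartBasis_apply]

theorem div_eq (hV : HasFieldGerm V v) : g.div V x = FunGerm.value ((germAlgebra g x).div v) := by
  have hd := (g.eventually_inner_dualFrame x).self_of_nhds
  simp only [← tanBasis_apply] at hd
  rw [div, g.trace_eq_sum (tanBasis x) hd, MetricLieRinehart.div, map_sum]
  refine Finset.sum_congr rfl fun i _ => ?_
  have h := (((g.hasFieldGerm_nablaField (HasFieldGerm.chartFrame i) hV).innerFields g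
    (g.hasFieldGerm_dualFrame i))).value
  rw [tanBasis_apply]
  exact h.symm

theorem nabla_eq (hU : HasFieldGerm U u) (hV : HasFieldGerm V v) :
    g.nabla V x (U x) = fieldValue x ((germAlgebra g x).nab u v) :=
  (g.hasFieldGerm_nablaField hU hV).fieldValue.symm

theorem hasGerm_dFlat_formula (hY : HasFieldGerm Y q) (hU : HasFieldGerm U u)
    (hV : HasFieldGerm V v) :
    HasGerm (fun y => dirDeriv U (fun z => g.form z (Y z) (V z)) y
      - dirDeriv V (fun z => g.form z (Y z) (U z)) y
      - g.form y (Y y) (mlieBracket (𝓡 n) U V y)) ((germAlgebra g x).dFlat q u v) :=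
  ((hU.dirDeriv (hY.innerFields g hV)).sub (hV.dirDeriv (hY.innerFields g hU))).sub
    (hY.innerFields g (hU.mlieBracket hV))

/-- The 2-form `emField g Y` computes the exterior derivative of `g(Y, ·)` on fields; such a form
exists because the exterior derivative is bilinear over the ring of germs. -/
theorem emField_apply (hY : SmoothFieldAt Y x) (hU : SmoothFieldAt U x) (hV : SmoothFieldAt V x) :
    emField g Y x (U x) (V x) = dirDeriv U (fun z => g.form z (Y z) (V z)) x
      - dirDeriv V (fun z => g.form z (Y z) (U z)) x
      - g.form x (Y x) (mlieBracket (𝓡 n) U V x) := by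
  obtain ⟨q, hq⟩ := hY.exists_germ
  refine Classical.epsilon_spec
    (p := fun A : LinearMap.BilinForm ℝ (Tan n x) =>
      ∀ U V : ∀ y : M, Tan n y, SmoothFieldAt U x → SmoothFieldAt V x →
        A (U x) (V x) = dirDeriv U (fun z => g.form z (Y z) (V z)) x
          - dirDeriv V (fun z => g.form z (Y z) (U z)) x
          - g.form x (Y x) (mlieBracket (𝓡 n) U V x))
    ⟨evalLin (evalLin (funValue x)) ((germAlgebra g x).dFlatLin q), fun U V hU hV => ?_⟩
    U V hU hV
  obtain ⟨u, hu⟩ := hU.exists_germ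
  obtain ⟨v, hv⟩ := hV.exists_germ
  rw [evalLin_apply _ _ hu, evalLin_apply _ _ hv]
  exact (g.hasGerm_dFlat_formula hq hu hv).funValue

theorem hasGerm_emField (hY : ∀ y, SmoothFieldAt Y y) (hq : HasFieldGerm Y q)
    (hU : HasFieldGerm U u) (hV : HasFieldGerm V v) :
    HasGerm (fun y => emField g Y y (U y) (V y)) ((germAlgebra g x).dFlat q u v) := by
  have h1 : ∀ i j, HasGerm (fun y => emField g Y y (chartFrame x i y) (chartFrame x j y))
      ((germAlgebra g x).dFlatLin q (Pi.single i 1) (Pi.single j 1)) := by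
    intro i j
    refine (g.hasGerm_dFlat_formula hq (HasFieldGerm.chartFrame i)
      (HasFieldGerm.chartFrame j)).congr ?_
    filter_upwards [eventually_mem_frameDomain n x] with y hy
    exact g.emField_apply (hY y) (smooth_chartFrame hy i) (smooth_chartFrame hy j)
  have h2 : ∀ i, HasGerm (fun y => emField g Y y (chartFrame x i y) (V y))
      ((germAlgebra g x).dFlatLin q (Pi.single i 1) v) := fun i =>
    hasGerm_of_chartFrame (φ := fun y => emField g Y y (chartFrame x i y)) (h1 i) hV
  exact hasGerm_of_chartFrame (φ := fun y => (emField g Y y).flip (V y))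
    (B := ((germAlgebra g x).dFlatLin q).flip v) h2 hU

/-- The exterior derivative of the electromagnetic field vanishes. -/
theorem extDerivTwo_emField (hY : ∀ y, SmoothFieldAt Y y) (x : M) :
    extDerivTwo (emField g Y) x = 0 := by
  obtain ⟨q, hq⟩ := (hY x).exists_germ
  -- the right-hand side of the invariant formula vanishes, so that the zero form satisfies it
  have hrhs : ∀ U V W : ∀ y : M, Tan n y, SmoothFieldAt U x → SmoothFieldAt V x →
      SmoothFieldAt W x →
      dirDeriv U (fun y => emField g Y y (V y) (W y)) x
        - dirDeriv V (fun y => emField g Y y (U y) (W y)) x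
        + dirDeriv W (fun y => emField g Y y (U y) (V y)) x
        - emField g Y x (mlieBracket (𝓡 n) U V x) (W x)
        + emField g Y x (mlieBracket (𝓡 n) U W x) (V x)
        - emField g Y x (mlieBracket (𝓡 n) V W x) (U x) = 0 := by
    intro U V W hU hV hW
    obtain ⟨u, hu⟩ := hU.exists_germ
    obtain ⟨v, hv⟩ := hV.exists_germ
    obtain ⟨w, hw⟩ := hW.exists_germ
    have h := (((((hu.dirDeriv (g.hasGerm_emField hY hq hv hw)).sub
      (hv.dirDeriv (g.hasGerm_emField hY hq hu hw))).add
      (hw.dirDeriv (g.hasGerm_emField hY hq hu hv))).sub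
      (g.hasGerm_emField hY hq (hu.mlieBracket hv) hw)).add
      (g.hasGerm_emField hY hq (hu.mlieBracket hw) hv)).sub
      (g.hasGerm_emField hY hq (hv.mlieBracket hw) hu)
    have h0 := (germAlgebra g x).dFlat_closed q u v w
    exact (h.value.symm.trans (congrArg FunGerm.value h0)).trans (map_zero _)
  have hspec : ∀ U V W : ∀ y : M, Tan n y, SmoothFieldAt U x → SmoothFieldAt V x →
      SmoothFieldAt W x → extDerivTwo (emField g Y) x (U x) (V x) (W x) = _ :=
    Classical.epsilon_spec
    (p := fun A : Tan n x →ₗ[ℝ] Tan n x →ₗ[ℝ] Tan n x →ₗ[ℝ] ℝ =>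
      ∀ U V W : ∀ y : M, Tan n y, SmoothFieldAt U x → SmoothFieldAt V x → SmoothFieldAt W x →
        A (U x) (V x) (W x) =
          dirDeriv U (fun y => emField g Y y (V y) (W y)) x
          - dirDeriv V (fun y => emField g Y y (U y) (W y)) x
          + dirDeriv W (fun y => emField g Y y (U y) (V y)) x
          - emField g Y x (mlieBracket (𝓡 n) U V x) (W x)
          + emField g Y x (mlieBracket (𝓡 n) U W x) (V x)
          - emField g Y x (mlieBracket (𝓡 n) V W x) (U x))
    ⟨0, fun U V W hU hV hW => (hrhs U V W hU hV hW).symm⟩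
  refine LinearMap.ext fun a => LinearMap.ext fun b => LinearMap.ext fun c => ?_
  have h := (hspec _ _ _ (smooth_extendTan x a) (smooth_extendTan x b)
    (smooth_extendTan x c)).trans (hrhs _ _ _ (smooth_extendTan x a) (smooth_extendTan x b)
    (smooth_extendTan x c))
  simpa only [extendTan_self, LinearMap.zero_apply] using h

/-- The covariant derivative of the electromagnetic field is computed in the algebra of germs. -/
theorem nablaForm_emField (hY : ∀ y, SmoothFieldAt Y y) (hq : HasFieldGerm Y q)
    (hU : HasFieldGerm U u) (hV : HasFieldGerm V v) (hW : HasFieldGerm W w) :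
    g.nablaForm (emField g Y) x (U x) (V x) (W x)
      = FunGerm.value ((germAlgebra g x).nabForm ((germAlgebra g x).dFlat q) u v w) := by
  have hval : ∀ {U V W : ∀ y : M, Tan n y} {u v w : FieldGerm n x}, HasFieldGerm U u →
      HasFieldGerm V v → HasFieldGerm W w →
      FunGerm.value ((germAlgebra g x).nabForm ((germAlgebra g x).dFlat q) u v w)
        = dirDeriv U (fun y => emField g Y y (V y) (W y)) x
          - emField g Y x (g.nablaField U V x) (W x)
          - emField g Y x (V x) (g.nablaField U W x) := fun hU hV hW =>
    (((hU.dirDeriv (g.hasGerm_emField hY hq hV hW)).sub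
      (g.hasGerm_emField hY hq (g.hasFieldGerm_nablaField hU hV) hW)).sub
      (g.hasGerm_emField hY hq hV (g.hasFieldGerm_nablaField hU hW))).value
  rw [hval hU hV hW]
  refine Classical.epsilon_spec
    (p := fun D : Tan n x →ₗ[ℝ] Tan n x →ₗ[ℝ] Tan n x →ₗ[ℝ] ℝ =>
      ∀ U V W : ∀ y : M, Tan n y, SmoothFieldAt U x → SmoothFieldAt V x → SmoothFieldAt W x →
        D (U x) (V x) (W x) = dirDeriv U (fun y => emField g Y y (V y) (W y)) x
          - emField g Y x (g.nablaField U V x) (W x)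
          - emField g Y x (V x) (g.nablaField U W x))
    ⟨evalLin (evalLin (evalLin (funValue x)))
      ((germAlgebra g x).nabFormLin ((germAlgebra g x).dFlatLin q)),
      fun U V W hU hV hW => ?_⟩ U V W hU.smooth hV.smooth hW.smooth
  obtain ⟨u, hu⟩ := hU.exists_germ
  obtain ⟨v, hv⟩ := hV.exists_germ
  obtain ⟨w, hw⟩ := hW.exists_germ
  rw [evalLin_apply _ _ hu, evalLin_apply _ _ hv, evalLin_apply _ _ hw]
  exact hval hu hv hw

theorem divForm_emField (hY : ∀ y, SmoothFieldAt Y y) (hq : HasFieldGerm Y q)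
    (hW : HasFieldGerm W w) :
    g.divForm (emField g Y) x (W x) = FunGerm.value (∑ i, (germAlgebra g x).nabForm
      ((germAlgebra g x).dFlat q) ((germAlgebra g x).frame i) ((germAlgebra g x).dual i) w) := by
  have hd := (g.eventually_inner_dualFrame x).self_of_nhds
  simp only [← tanBasis_apply] at hd
  -- the trilinear form with its last argument fixed
  let T := (germAlgebra g x).nabFormLin ((germAlgebra g x).dFlatLin q)
  let B : FieldGerm n x →ₗ[FunGerm n x] FieldGerm n x →ₗ[FunGerm n x] FunGerm n x :=
    LinearMap.mk₂ _ (fun u v => T u v w) (by simp) (by simp) (by simp) (by simp)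
  have hc := (germAlgebra g x).sum_frame_dual_comm B
  refine (g.metricTrace_eq_sum (tanBasis x) hd _).trans ?_
  refine Eq.trans ?_ (congrArg FunGerm.value hc).symm
  rw [map_sum]
  refine Finset.sum_congr rfl fun i _ => ?_
  rw [tanBasis_apply]
  exact g.nablaForm_emField hY hq (g.hasFieldGerm_dualFrame i) (HasFieldGerm.chartFrame i) hW

end SemiRiemannianMetric

/-! ### Germs of Killing fields -/

namespace MetricLieRinehart

variable {A X ι : Type*} [CommRing A] [AddCommGroup X] [Module A X] [Fintype ι] [DecidableEq ι]
  (L : MetricLieRinehart A X ι)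

/-- The Lie derivative of the metric along `y`, as a bilinear form. -/
def lieForm (y : X) : X →ₗ[A] X →ₗ[A] A :=
  LinearMap.mk₂ A (fun u v => L.act y (L.g u v) - L.g (L.br y u) v - L.g u (L.br y v))
    (fun u u' v => by simp only [map_add, LinearMap.add_apply, L.act_add, L.br_add]; ring)
    (fun a u v => by
      simp only [map_add, map_smul, LinearMap.add_apply, LinearMap.smul_apply, smul_eq_mul,
        L.act_mul, L.br_smul]
      ring)
    (fun u v v' => by simp only [map_add, L.act_add, L.br_add]; ring)
    (fun a u v => by
      simp only [map_add, map_smul, smul_eq_mul, L.act_mul, L.br_smul]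
      ring)

/-- A field that satisfies the Killing equation on a frame is a Killing field. -/
theorem isKilling_of_frame {y : X}
    (h : ∀ i j, L.act y (L.g (L.frame i) (L.frame j))
      = L.g (L.br y (L.frame i)) (L.frame j) + L.g (L.frame i) (L.br y (L.frame j))) :
    L.IsKilling y := fun u v => by
  have h0 : L.lieForm y u v = 0 := by
    rw [← L.sum_frame u, ← L.sum_frame v]
    simp only [map_sum, map_smul, LinearMap.sum_apply, LinearMap.smul_apply]
    refine Finset.sum_eq_zero fun i _ => ?_
    refine (congrArg _ (Finset.sum_eq_zero fun j _ => ?_)).trans (smul_zero _)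
    rw [show L.lieForm y (L.frame j) (L.frame i) = 0 from by
      rw [lieForm, LinearMap.mk₂_apply, h]; ring, smul_zero]
  rw [lieForm, LinearMap.mk₂_apply] at h0
  linear_combination h0

end MetricLieRinehart

namespace SemiRiemannianMetric

variable {n : ℕ} {M : Type*} [TopologicalSpace M] [ChartedSpace (EuclideanSpace ℝ (Fin n)) M]
  [IsManifold (𝓡 n) ∞ M] {g : SemiRiemannianMetric n M} {x : M} {Y V : ∀ y : M, Tan n y}
  {q v : FieldGerm n x}

/-- It suffices to know the Killing equation on the chart frame. -/
theorem IsKilling.germ (hK : g.IsKilling Y) (hq : HasFieldGerm Y q) :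
    (germAlgebra g x).IsKilling q := by
  refine (germAlgebra g x).isKilling_of_frame fun i j => ?_
  have hi := HasFieldGerm.chartFrame (x := x) i
  have hj := HasFieldGerm.chartFrame (x := x) j
  refine (hq.dirDeriv (hi.innerFields g hj)).unique
    (((hq.mlieBracket hi).innerFields g hj).add (hi.innerFields g (hq.mlieBracket hj))) ?_
  filter_upwards [eventually_mem_frameDomain n x] with z hz
  exact hK z _ _ (smooth_chartFrame hz i) (smooth_chartFrame hz j)

/-- The electromagnetic field of a Killing potential acts as `-2 ∇Y`. -/
theorem IsKilling.endo_emField (hK : g.IsKilling Y) (hY : ∀ y, SmoothFieldAt Y y)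
    (hq : HasFieldGerm Y q) (hV : HasFieldGerm V v) : g.endo x (emField g Y x) (V x)
      = (-2 : ℝ) • fieldValue x ((germAlgebra g x).nab v q) := by
  refine g.eq_of_inner fun w => ?_
  obtain ⟨u, hu⟩ := (smooth_extendTan x w).exists_germ
  have hN := (g.hasFieldGerm_nablaField hV hq)
  have h1 := (g.hasGerm_emField hY hq hu hV).value
  have h2 := (hN.innerFields g hu).value
  have h3 : (germAlgebra g x).dFlat q u v
      = -2 * germForm g x ((germAlgebra g x).nab v q) u := by
    rw [(hK.germ hq).dFlat_eq, (hK.germ hq).g_nab_skew]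
    change 2 * -(germForm g x _ _) = _
    ring
  rw [hN.fieldValue, g.symm, inner_endo]
  rw [h3, map_mul, map_neg, map_ofNat, h2] at h1
  simp only [innerFields, extendTan_self] at h1
  rw [← h1]
  simp

end SemiRiemannianMetric

/-! ### Germs of charged dust -/

section Dust

variable {m : ℕ} {M B W : Type*}
  [TopologicalSpace M] [ChartedSpace (EuclideanSpace ℝ (Fin (5 + m))) M]
  [IsManifold (𝓡 (5 + m)) ∞ M]
  [TopologicalSpace B] [ChartedSpace (EuclideanSpace ℝ (Fin 4)) B]
  [TopologicalSpace W] [ChartedSpace (EuclideanSpace ℝ (Fin m)) W]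

/-- The germs of the data of charged dust satisfy the algebraic charged dust equations. -/
theorem IsChargedDust.isDust {P : MultiFiberBundle m M B W} {g : SemiRiemannianMetric (5 + m) M}
    {Y : ∀ x : M, Tan (5 + m) x} (hY : P.IsPotential g Y) (hK : g.IsKilling Y)
    {Ω : Set M} {μ α e γ : M → ℝ} {X X₀ : ∀ x : M, Tan (5 + m) x}
    (hΩ : IsChargedDust P g Y Ω μ α e γ X X₀) {x : M} (hx : x ∈ Ω)
    {y x₀ : FieldGerm (5 + m) x} {a b c : FunGerm (5 + m) x} (hy : HasFieldGerm Y y)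
    (hx₀ : HasFieldGerm X₀ x₀) (ha : HasGerm μ a) (hb : HasGerm e b) (hc : HasGerm γ c) :
    (germAlgebra g x).IsDust y x₀ a b c where
  killing := hK.germ hy
  unit_y := (hy.innerFields g hy).unique HasGerm.one.neg (Filter.Eventually.of_forall hY.unit)
  unit_x := (hx₀.innerFields g hx₀).unique HasGerm.one.neg (by
    filter_upwards [hΩ.isOpen.mem_nhds hx] with z hz using hΩ.unit z hz)
  orth := (hx₀.innerFields g hy).unique HasGerm.zero (by
    filter_upwards [hΩ.isOpen.mem_nhds hx] with z hz using hΩ.orthogonal z hz)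
  isUnit := FunGerm.isUnit (by rw [ha.value]; exact (hΩ.mass_pos x hx).ne')
  einstein u v := by
    have hu := u.hasFieldGerm_rep
    have hv := v.hasFieldGerm_rep
    have h1 := (HasGerm.two.mul (g.hasGerm_ricci hu hv)).sub
      ((g.hasGerm_scalarCurvature x).mul (hu.innerFields g hv))
    have h2 := HasGerm.two.mul (((ha.mul ((hx₀.innerFields g hu).mul (hx₀.innerFields g hv))).add
      (hb.mul (((hx₀.innerFields g hu).mul (hy.innerFields g hv)).add
        ((hy.innerFields g hu).mul (hx₀.innerFields g hv))))).add
      (hc.mul ((hy.innerFields g hu).mul (hy.innerFields g hv))))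
    refine h1.unique h2 ?_
    filter_upwards [hΩ.isOpen.mem_nhds hx] with z hz
    have h := hΩ.einstein_eq_classical z hz (u.rep z) (v.rep z)
    have h' : g.einstein z (u.rep z) (v.rep z) = g.ricci z (u.rep z) (v.rep z)
        - g.scalarCurvature z / 2 * g.inner z (u.rep z) (v.rep z) := rfl
    rw [h'] at h
    simp only [SemiRiemannianMetric.innerFields]
    linear_combination 2 * h

end Dust

end

theorem mainTheorem1 {m : ℕ} {M B W : Type*}
    [TopologicalSpace M] [ChartedSpace (EuclideanSpace ℝ (Fin (5 + m))) M]
    [IsManifold (𝓡 (5 + m)) ∞ M] [T2Space M] [SecondCountableTopology M]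
    [TopologicalSpace B] [ChartedSpace (EuclideanSpace ℝ (Fin 4)) B]
    [IsManifold (𝓡 4) ∞ B] [T2Space B] [SecondCountableTopology B]
    [TopologicalSpace W] [ChartedSpace (EuclideanSpace ℝ (Fin m)) W]
    [IsManifold (𝓡 m) ∞ W] [T2Space W] [CompactSpace W]
    (P : MultiFiberBundle m M B W) (g : SemiRiemannianMetric (5 + m) M)
    (hg : P.IsCompatible g)
    (Y : ∀ x : M, Tan (5 + m) x) (hY : P.IsPotential g Y) (hK : g.IsKilling Y)
    (Ω : Set M) (μ α e γ : M → ℝ) (X X₀ : ∀ x : M, Tan (5 + m) x)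
    (hΩ : IsChargedDust P g Y Ω μ α e γ X X₀) :
    ∀ x ∈ Ω,
      -- conservation laws
      (dirDeriv X₀ (fun y => e y / μ y) x = 0 ∧
        g.div (fun y => μ y • X₀ y) x = 0 ∧
        g.div (fun y => e y • X₀ y) x = 0) ∧
      -- Maxwell equations
      (extDerivTwo (emField g Y) x = 0 ∧
        g.sharp x (g.divForm (emField g Y) x)
          = (2 * e x) • X₀ x + (2 * γ x - g.scalarCurvature x) • Y x) ∧
      -- free fall
      g.nabla X x (X x) = 0 ∧
      -- Lorentz equation
      μ x • g.nabla X₀ x (X₀ x) = e x • g.endo x (emField g Y x) (X₀ x) ∧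
      -- the acceleration of the visible field is orthogonal to the potential
      g.inner x (g.nabla X₀ x (X₀ x)) (Y x) = 0 ∧
      -- free fall for `X` is the Lorentz equation for `X₀`
      μ x • g.nabla X x (X x)
        = μ x • g.nabla X₀ x (X₀ x) - e x • g.endo x (emField g Y x) (X₀ x) := by
  intro x hx
  have hnhds := hΩ.isOpen.mem_nhds hx
  have hYs : ∀ y, SmoothFieldAt Y y := fun y => hY.smooth.contMDiffAt Filter.univ_mem
  have hμx : μ x ≠ 0 := (hΩ.mass_pos x hx).ne'
  obtain ⟨y, hy⟩ := (hYs x).exists_germ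
  obtain ⟨x₀, hx₀⟩ := SmoothFieldAt.exists_germ (hΩ.smooth_X₀.contMDiffAt hnhds)
  obtain ⟨a, ha⟩ := SmoothFunAt.exists_germ (hΩ.smooth_μ.contMDiffAt hnhds)
  obtain ⟨b, hb⟩ := SmoothFunAt.exists_germ (hΩ.smooth_e.contMDiffAt hnhds)
  obtain ⟨c, hc⟩ := SmoothFunAt.exists_germ (hΩ.smooth_γ.contMDiffAt hnhds)
  obtain ⟨q, hq⟩ := SmoothFunAt.exists_germ (n := 5 + m) (f := fun y => e y / μ y) (x := x)
    (ContMDiffAt.div₀ hb.smooth ha.smooth hμx)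
  -- `e / μ` has no junk value near `x`, because `μ > 0` on the open set `Ω`
  have hqa : q * a = b := (hq.mul ha).unique hb (by
    filter_upwards [hnhds] with z hz using div_mul_cancel₀ _ (hΩ.mass_pos z hz).ne')
  have hX : HasFieldGerm X (x₀ + q • y) := (hx₀.add (HasFieldGerm.smul hq hy)).congr (by
    filter_upwards [hnhds] with z hz using hΩ.field_eq z hz)
  have hD := hΩ.isDust hY hK hx hy hx₀ ha hb hc
  have hXX := g.nabla_eq hX hX
  have hX₀X₀ := g.nabla_eq hx₀ hx₀
  have hF := hK.endo_emField hYs hy hx₀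
  -- the acceleration of `X` is expanded into that of `X₀` and the Lorentz force
  have hlast : μ x • g.nabla X x (X x)
      = μ x • g.nabla X₀ x (X₀ x) - e x • g.endo x (emField g Y x) (X₀ x) := by
    have h := congrArg (fieldValue x) (hD.smul_nab_total hqa)
    rw [map_add, LinearMap.map_smulₛₗ, LinearMap.map_smulₛₗ, LinearMap.map_smulₛₗ, map_mul,
      map_ofNat, ha.value, hb.value] at h
    rw [hXX, hX₀X₀, hF, h]
    module
  have hgeo : g.nabla X x (X x) = 0 := by rw [hXX, hD.geodesic hqa, map_zero]
  refine ⟨⟨?_, ?_, ?_⟩, ⟨g.extDerivTwo_emField hYs x, ?_⟩, hgeo, ?_, ?_, hlast⟩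
  · refine (hx₀.dirDeriv hq).value.symm.trans ?_
    exact (congrArg FunGerm.value (hD.act_quotient hqa)).trans (map_zero _)
  · exact (g.div_eq (HasFieldGerm.smul ha hx₀)).trans (by rw [hD.div_μ, map_zero])
  · exact (g.div_eq (HasFieldGerm.smul hb hx₀)).trans (by rw [hD.div_e, map_zero])
  · refine g.eq_of_inner fun w => ?_
    obtain ⟨u, hu⟩ := (smooth_extendTan x w).exists_germ
    have h1 := g.divForm_emField hYs hy hu
    rw [hD.maxwell] at h1
    have h2 : HasFieldGerm (fun z => (2 * e z) • X₀ z + (2 * γ z - g.scalarCurvature z) • Y z)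
        ((2 * b) • x₀ + (2 * c - (germAlgebra g x).scal) • y) :=
      (HasFieldGerm.smul (HasGerm.two.mul hb) hx₀).add
        (HasFieldGerm.smul ((HasGerm.two.mul hc).sub (g.hasGerm_scalarCurvature x)) hy)
    have h3 := h1.trans (h2.innerFields g hu).value
    simp only [SemiRiemannianMetric.innerFields, extendTan_self] at h3
    rw [g.inner_sharp, h3]
  · rw [hgeo, smul_zero] at hlast
    exact sub_eq_zero.mp hlast.symm
  · rw [hX₀X₀, (g.hasFieldGerm_nablaField hx₀ hx₀).fieldValue]
    refine ((g.hasFieldGerm_nablaField hx₀ hx₀).innerFields g hy).value.symm.trans ?_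
    exact (congrArg FunGerm.value hD.g_nab_x_y).trans (map_zero _)
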